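/- Let $K$ be an algebraically closed field of characteristic zero, $n\ge 4$, $2\le r\le n-2$, $e\ge 1$, and let $G=G(r,n)$ be the Grassmannian of $r$-dimensional subspaces of $K^n$, with universal subbundle $\mathcal S$, universal quotient bundle $\mathcal Q$ and tangent bundle $T_G\cong\mathcal S^*\otimes\mathcal Q$. Let $\mathrm{Mor}_e$ be the space of morphisms $f:\mathbb P^1\to G$ of degree $e$ (that is, $\deg f^*\mathcal S^*=e$) with its Zariski topology. For integers $a_\bullet=(a_1,\dots,a_r)$ and $b_\bullet=(b_1,\dots,b_{n-r})$ put $$M'(a_\bullet)=\{f: f^*\mathcal S^*\cong\textstyle\bigoplus_i\mathcal O(a_i)\},\qquad M(b_\bullet)=\{f: f^*\mathcal Q\cong\textstyle\bigoplus_j\mathcal O(b_j)\}.$$ Let $c_1,\dots,c_{r(n-r)}$ be integers. A filling of $\{c_l\}$ is an $r\times(n-r)$ matrix $A=(A_{i,j})$ whose entries are the $c_l$, each index $l$ used exactly once, whose entries are weakly increasing along every row and every column, and such that $A_{i+1,j}-A_{i,j}$ does not depend on $j$ and $A_{i,j+1}-A_{i,j}$ does not depend on $i$. Consider the fillings $A$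 with $\frac1n\sum_{i,j}A_{i,j}=e$ for which the numbers $$a_i=\frac1{n-r}\Big(\sum_jA_{i,j}-e\Big),\qquad b_j=\frac1r\Big(\sum_iA_{i,j}-e\Big)$$ are non-negative integers; write $a_\bullet(A)$, $b_\bullet(A)$ for the (then weakly increasing) sequences so obtained. **Proposition.** The locus $\{f\in\mathrm{Mor}_e: f^*T_G\cong\bigoplus_l\mathcal O(c_l)\}$ is stratified by the loci $M(b_\bullet(A))\cap M'(a_\bullet(A))$, where $A$ runs over these fillings. That is, the locus is the union of these finitely many sets, the sets belonging to distinct fillings are disjoint, each of them is locally closed in $\mathrm{Mor}_e$, and whenever one of them meets the closure of another (in $\mathrm{Mor}_e$) it is contained in that closure. -/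

import Mathlib

noncomputable section

open LaurentPolynomial Polynomial TensorProduct

universe u v w

namespace GrassmannianCurves

/-! ### Points of the Grassmannian and base change -/

section BaseChange

variable {A : Type u} {A' : Type v} [CommRing A] [CommRing A'] (f : A →+* A') {n k : ℕ}

/-- The extension of scalars along `f : A → A'` of a submodule `N ⊆ A ^ n`, seen inside `A' ^ n`. -/
def extend (N : Submodule A (Fin n → A)) : Submodule A' (Fin n → A') :=
  Submodule.span A' ((fun v : Fin n → A => fun j => f (v j)) '' (N : Set (Fin n → A)))

theorem exists_quotient_equiv [Algebra A A'] (N : Submodule A (Fin n → A)) :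
    Nonempty ((A' ⊗[A] ((Fin n → A) ⧸ N)) ≃ₗ[A'] ((Fin n → A') ⧸ extend (algebraMap A A') N)) := by
  have hsurj : Function.Surjective (N.mkQ.baseChange A') :=
    LinearMap.baseChange_surjective A' (Submodule.mkQ_surjective _)
  have hker : (N.mkQ.baseChange A').ker = N.baseChange A' := by
    have hex : Function.Exact N.subtype N.mkQ := LinearMap.exact_subtype_mkQ N
    have h := lTensor_exact A' hex (Submodule.mkQ_surjective N)
    rw [Submodule.baseChange_eq_span]
    apply le_antisymm
    · intro x hx
      obtain ⟨y, rfl⟩ := (h x).1 hx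
      induction y with
      | zero => simp
      | tmul a m =>
        have : (LinearMap.lTensor A' N.subtype) (a ⊗ₜ[A] m)
            = a • ((1 : A') ⊗ₜ[A] (m : Fin n → A)) := by
          simp [TensorProduct.smul_tmul']
        rw [this]
        exact Submodule.smul_mem _ _ (Submodule.subset_span ⟨m, m.2, rfl⟩)
      | add y z hy hz =>
        rw [map_add]
        refine Submodule.add_mem _ (hy ?_) (hz ?_)
        · exact (h _).2 ⟨y, rfl⟩
        · exact (h _).2 ⟨z, rfl⟩
    · rw [Submodule.span_le]
      rintro _ ⟨m, hm, rfl⟩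
      simp only [SetLike.mem_coe] at hm
      simp [(Submodule.Quotient.mk_eq_zero N).2 hm]
  let e := TensorProduct.piScalarRight A A' A' (Fin n)
  have hmap : (N.mkQ.baseChange A').ker.map (e : A' ⊗[A] (Fin n → A) →ₗ[A'] (Fin n → A'))
      = extend (algebraMap A A') N := by
    rw [hker, Submodule.baseChange_eq_span, Submodule.map_span, extend]
    congr 1
    rw [Submodule.map_coe, ← Set.image_comp]
    apply Set.image_congr
    intro m _
    ext j
    simp [e, Algebra.smul_def]
  exact ⟨((N.mkQ.baseChange A').quotKerEquivOfSurjective hsurj).symm.trans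
    (Submodule.Quotient.equiv _ _ e hmap)⟩

/-- The map `G(A) → G(A')` of points of the Grassmannian induced by `f : A → A'`. Here
`Module.Grassmannian A (Fin n → A) k` is the set of submodules of `A ^ n` whose quotient is
locally free of rank `k`. -/
def pointMap (N : Module.Grassmannian A (Fin n → A) k) :
    Module.Grassmannian A' (Fin n → A') k where
  toSubmodule := extend f N.toSubmodule
  finite_quotient := by
    let : Algebra A A' := f.toAlgebra
    obtain ⟨e⟩ := exists_quotient_equiv (A' := A') N.toSubmodule
    exact Module.Finite.equiv e
  projective_quotient := by
    let : Algebra A A' := f.toAlgebra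
    obtain ⟨e⟩ := exists_quotient_equiv (A' := A') N.toSubmodule
    exact Module.Projective.of_equiv e
  rankAtStalk_eq p := by
    let : Algebra A A' := f.toAlgebra
    obtain ⟨e⟩ := exists_quotient_equiv (A' := A') N.toSubmodule
    have h := congrFun (Module.rankAtStalk_eq_of_equiv e) p
    rw [Module.rankAtStalk_baseChange, N.rankAtStalk_eq] at h
    exact h.symm

theorem pointMap_comp {A'' : Type w} [CommRing A''] (g : A' →+* A'')
    (N : Module.Grassmannian A (Fin n → A) k) :
    pointMap g (pointMap f N) = pointMap (g.comp f) N := by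
  apply Module.Grassmannian.ext
  change extend g (extend f N.toSubmodule) = extend (g.comp f) N.toSubmodule
  apply le_antisymm
  · refine Submodule.span_le.2 ?_
    rintro _ ⟨w, hw, rfl⟩
    induction hw using Submodule.span_induction with
    | mem x hx =>
      obtain ⟨v, hv, rfl⟩ := hx
      exact Submodule.subset_span ⟨v, hv, rfl⟩
    | zero => simp only [Pi.zero_apply, map_zero]; exact Submodule.zero_mem (extend (g.comp f) N.toSubmodule)
    | add x y _ _ hx hy => simpa using! Submodule.add_mem _ hx hy
    | smul a x _ hx => simpa using! Submodule.smul_mem _ (g a) hx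
  · refine Submodule.span_le.2 ?_
    rintro _ ⟨v, hv, rfl⟩
    exact Submodule.subset_span ⟨fun j => f (v j), Submodule.subset_span ⟨v, hv, rfl⟩, rfl⟩

end BaseChange

/-! ### Morphisms from the projective line to the Grassmannian -/

section Morphisms

/-- The projective line over `R` is glued from two copies of `Spec R[X]` (coordinate `T` on chart
`0`, coordinate `T⁻¹` on chart `1`) along `Spec R[T;T⁻¹]`. This is the restriction map from the
functions on chart `i` to the functions on the overlap. -/
def chartHom (R : Type u) [CommRing R] : Fin 2 → (R[X] →ₐ[R] R[T;T⁻¹]) :=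
  ![toLaurentAlg, (invert (R := R)).toAlgHom.comp toLaurentAlg]

/-- A morphism `ℙ¹_R → G(r, n)`: a point of `G(r, n)` over each of the two charts, with equal
restrictions to the overlap. A point of `G(r, n)` over a ring `A` is a submodule of `A ^ n` whose
quotient is locally free of rank `n - r`. Over a base ring `R` these are the families,
parametrized by `Spec R`, of morphisms `ℙ¹ → G(r, n)`. -/
@[ext] structure Morphism (R : Type u) [CommRing R] (r n : ℕ) where
  onChart : Fin 2 → Module.Grassmannian R[X] (Fin n → R[X]) (n - r)
  agree : pointMap (chartHom R 0).toRingHom (onChart 0) =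
    pointMap (chartHom R 1).toRingHom (onChart 1)

/-- The coefficientwise map `R[T;T⁻¹] → R'[T;T⁻¹]`. -/
def overlapMap {R : Type u} {R' : Type v} [CommRing R] [CommRing R'] (p : R →+* R') :
    R[T;T⁻¹] →+* R'[T;T⁻¹] :=
  AddMonoidAlgebra.mapRingHom ℤ p

theorem overlapMap_C {R : Type u} {R' : Type v} [CommRing R] [CommRing R'] (p : R →+* R') (a : R) :
    overlapMap p (LaurentPolynomial.C a) = LaurentPolynomial.C (p a) :=
  AddMonoidAlgebra.mapRingHom_single (M := ℤ) p 0 a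

theorem overlapMap_T {R : Type u} {R' : Type v} [CommRing R] [CommRing R'] (p : R →+* R') (m : ℤ) :
    overlapMap p (T m) = T m := by
  have h := AddMonoidAlgebra.mapRingHom_single p m (1 : R)
  rw [map_one] at h
  exact h

theorem chartHom_natural {R : Type u} {R' : Type v} [CommRing R] [CommRing R'] (p : R →+* R')
    (i : Fin 2) : ((chartHom R' i).toRingHom).comp (Polynomial.mapRingHom p) =
      (overlapMap p).comp (chartHom R i).toRingHom := by
  fin_cases i <;> refine Polynomial.ringHom_ext (fun a => ?_) ?_ <;>
    simp [chartHom, overlapMap_C, overlapMap_T]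

/-- The pullback of a family of morphisms along `Spec R' → Spec R`. -/
def Morphism.pullback {R : Type u} {R' : Type v} [CommRing R] [CommRing R'] {r n : ℕ}
    (Φ : Morphism R r n) (p : R →+* R') : Morphism R' r n where
  onChart i := pointMap (Polynomial.mapRingHom p) (Φ.onChart i)
  agree := by
    rw [pointMap_comp, pointMap_comp, chartHom_natural, chartHom_natural, ← pointMap_comp,
      ← pointMap_comp, Φ.agree]

/-- The Zariski topology on the `K`-points of `Spec R`. -/
abbrev zariskiPoints (K R : Type u) [Field K] [CommRing R] [Algebra K R] :
    TopologicalSpace (R →ₐ[K] K) :=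
  TopologicalSpace.induced
    (fun p => (⟨RingHom.ker p, RingHom.ker_isPrime p⟩ : PrimeSpectrum R)) inferInstance

/-- The Zariski topology on the set of `K`-points of the scheme of morphisms `ℙ¹ → G(r, n)`: the
finest topology for which the classifying map `(Spec R)(K) → Mor(ℙ¹, G(r, n))(K)` of every family
over every `K`-algebra `R` is continuous. So a set of morphisms is closed if and only if, in every
family, the parameters whose morphism lies in the set form a Zariski closed set. -/
instance zariskiTopology (K : Type u) [Field K] (r n : ℕ) : TopologicalSpace (Morphism K r n) :=
  ⨆ (R : Type u) (_ : CommRing R) (_ : Algebra K R) (Φ : Morphism R r n),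
    TopologicalSpace.coinduced (fun p : R →ₐ[K] K => Φ.pullback p.toRingHom) (zariskiPoints K R)

end Morphisms

/-! ### Vector bundles on the projective line -/

section Bundles

variable (K : Type u) [Field K]

/-- The functions on chart `i`, as a subring of the functions on the overlap: `K[T]` for `i = 0`
and `K[T⁻¹]` for `i = 1`. -/
def chartRing (i : Fin 2) : Subalgebra K K[T;T⁻¹] := (chartHom K i).range

/-- A vector bundle on `ℙ¹`: the module of its sections over the overlap of the two charts,
together with the submodules of those sections that extend to chart `0` and to chart `1`
(restriction of sections of a vector bundle from a chart to the overlap is injective). The sections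
over chart `i` form a finitely generated module over `chartRing K i`, whose localization is the
module of sections over the overlap. It is locally free: it is torsion free over a polynomial
ring in one variable, because the sections over the overlap are projective. -/
structure VectorBundle where
  Overlap : Type u
  [addCommGroup : AddCommGroup Overlap]
  [module : Module K[T;T⁻¹] Overlap]
  projective : Module.Projective K[T;T⁻¹] Overlap
  sections : ∀ i : Fin 2, Submodule (chartRing K i) Overlap
  sections_fg : ∀ i, (sections i).FG
  span_sections : ∀ i, Submodule.span K[T;T⁻¹] (sections i : Set Overlap) = ⊤

attribute [instance] VectorBundle.addCommGroup VectorBundle.module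

variable {K}

namespace VectorBundle

/-- Two vector bundles on `ℙ¹` are isomorphic. -/
def Isomorphic (E F : VectorBundle K) : Prop :=
  ∃ g : E.Overlap ≃ₗ[K[T;T⁻¹]] F.Overlap, ∀ i v, v ∈ E.sections i ↔ g v ∈ F.sections i

/-- The bundle `⨁ j, 𝒪(a j)` on `ℙ¹`. The summand `𝒪(d)` has sections `K[T]` over chart `0` and
`T ^ d • K[T⁻¹]` over chart `1`. -/
def sumLineBundles {m : ℕ} (a : Fin m → ℤ) : VectorBundle K where
  Overlap := Fin m → K[T;T⁻¹]
  projective := inferInstance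
  sections i := Submodule.span (chartRing K i)
    (Set.range fun j => Pi.single j (T ((![0, a j] : Fin 2 → ℤ) i)))
  sections_fg i := Submodule.fg_span (Set.finite_range _)
  span_sections i := by
    rw [Submodule.span_span_of_tower]
    rw [eq_top_iff, ← (Pi.basisFun K[T;T⁻¹] (Fin m)).span_eq, Submodule.span_le]
    rintro _ ⟨j, rfl⟩
    have h := Submodule.smul_mem (Submodule.span K[T;T⁻¹]
      (Set.range fun j => (Pi.single j (T ((![0, a j] : Fin 2 → ℤ) i)) : Fin m → K[T;T⁻¹])))
      (T (-(![0, a j] : Fin 2 → ℤ) i)) (Submodule.subset_span ⟨j, rfl⟩)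
    rw [← Pi.single_smul', smul_eq_mul, ← T_add, neg_add_cancel, T_zero] at h
    simpa using h

/-- `E ≅ ⨁ j, 𝒪(a j)`, that is, `E` has splitting type `a` (up to the order of the `a j`). -/
def HasSplittingType (E : VectorBundle K) {m : ℕ} (a : Fin m → ℤ) : Prop :=
  E.Isomorphic (sumLineBundles a)

/-- `E` has degree `d`: the determinant of the transition matrix from a frame over chart `0` to a
frame over chart `1` is a unit of `K` times `T ^ d`. -/
def HasDegree (E : VectorBundle K) (d : ℤ) : Prop :=
  ∃ (m : ℕ) (v : Module.Basis (Fin m) (chartRing K 0) (E.sections 0))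
    (w : Module.Basis (Fin m) (chartRing K 1) (E.sections 1))
    (M : Matrix (Fin m) (Fin m) K[T;T⁻¹]) (c : K), c ≠ 0 ∧
    (∀ j, (w j : E.Overlap) = ∑ i, M i j • (v i : E.Overlap)) ∧
    M.det = LaurentPolynomial.C c * T d

instance (i : Fin 2) : IsNoetherianRing (chartRing K i) :=
  isNoetherianRing_of_surjective K[X] _ (chartHom K i).rangeRestrict.toRingHom
    (chartHom K i).rangeRestrict_surjective

theorem T_mem_chartRing (i : Fin 2) (k : ℕ) :
    (T ((![1, -1] : Fin 2 → ℤ) i * k) : K[T;T⁻¹]) ∈ chartRing K i := by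
  refine ⟨Polynomial.X ^ k, ?_⟩
  fin_cases i
  · change toLaurent (Polynomial.X ^ k) = T (1 * (k : ℤ))
    rw [toLaurent_X_pow, one_mul]
  · change invert (toLaurent (Polynomial.X ^ k)) = T (-1 * (k : ℤ))
    rw [toLaurent_X_pow, invert_T, neg_one_mul]

theorem exists_T_mul_mem (i : Fin 2) (f : K[T;T⁻¹]) :
    ∃ m : ℕ, ∀ k : ℕ, m ≤ k → T ((![1, -1] : Fin 2 → ℤ) i * k) * f ∈ chartRing K i := by
  have key : ∃ m : ℕ, T ((![1, -1] : Fin 2 → ℤ) i * m) * f ∈ chartRing K i := by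
    fin_cases i
    · obtain ⟨m, g, hg⟩ := exists_T_pow f
      refine ⟨m, g, ?_⟩
      change toLaurent g = T (1 * (m : ℤ)) * f
      rw [hg, one_mul, mul_comm]
    · obtain ⟨m, g, hg⟩ := exists_T_pow (invert f)
      refine ⟨m, g, ?_⟩
      change invert (toLaurent g) = T (-1 * (m : ℤ)) * f
      rw [hg, map_mul, involutive_invert f, invert_T, neg_one_mul, mul_comm]
  obtain ⟨m, hm⟩ := key
  refine ⟨m, fun k hk => ?_⟩
  obtain ⟨d, rfl⟩ := Nat.exists_eq_add_of_le hk
  have h := mul_mem (T_mem_chartRing (K := K) i d) hm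
  rwa [← mul_assoc, ← T_add, ← mul_add, add_comm (d : ℤ), ← Nat.cast_add] at h

/-- The tensor product of two vector bundles. -/
def tensor (E F : VectorBundle K) : VectorBundle K where
  Overlap := E.Overlap ⊗[K[T;T⁻¹]] F.Overlap
  projective := by
    have := E.projective
    have := F.projective
    infer_instance
  sections i := Submodule.span (chartRing K i)
    {x | ∃ v ∈ E.sections i, ∃ w ∈ F.sections i, v ⊗ₜ[K[T;T⁻¹]] w = x}
  sections_fg i := by
    obtain ⟨s, hs⟩ := E.sections_fg i
    obtain ⟨t, ht⟩ := F.sections_fg i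
    refine Submodule.fg_def.2
      ⟨Set.image2 (fun v w => v ⊗ₜ[K[T;T⁻¹]] w) s t, s.finite_toSet.image2 _ t.finite_toSet, ?_⟩
    apply le_antisymm
    · refine Submodule.span_le.2 ?_
      rintro _ ⟨v, hv, w, hw, rfl⟩
      exact Submodule.subset_span
        ⟨v, hs ▸ Submodule.subset_span hv, w, ht ▸ Submodule.subset_span hw, rfl⟩
    · refine Submodule.span_le.2 ?_
      rintro _ ⟨v, hv, w, hw, rfl⟩
      rw [← hs] at hv
      rw [← ht] at hw
      change v ⊗ₜ[K[T;T⁻¹]] w ∈ Submodule.span (chartRing K i) _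
      induction hv using Submodule.span_induction with
      | mem v hv =>
        induction hw using Submodule.span_induction with
        | mem w hw => exact Submodule.subset_span ⟨v, hv, w, hw, rfl⟩
        | zero => rw [tmul_zero]; exact zero_mem _
        | add x y _ _ hx hy => rw [tmul_add]; exact add_mem hx hy
        | smul a x _ hx =>
          have h : v ⊗ₜ[K[T;T⁻¹]] (a • x) = a • (v ⊗ₜ[K[T;T⁻¹]] x) :=
            tmul_smul (a : K[T;T⁻¹]) v x
          rw [h]
          exact Submodule.smul_mem _ _ hx
      | zero => rw [zero_tmul]; exact zero_mem _
      | add x y _ _ hx hy => rw [add_tmul]; exact add_mem hx hy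
      | smul a x _ hx =>
        have h : (a • x) ⊗ₜ[K[T;T⁻¹]] w = a • (x ⊗ₜ[K[T;T⁻¹]] w) :=
          (smul_tmul' (a : K[T;T⁻¹]) x w).symm
        rw [h]
        exact Submodule.smul_mem _ _ hx
  span_sections i := by
    rw [Submodule.span_span_of_tower, eq_top_iff, ← span_tmul_eq_top, Submodule.span_le]
    rintro _ ⟨v, w, rfl⟩
    have hv : v ∈ Submodule.span K[T;T⁻¹] (E.sections i : Set E.Overlap) :=
      E.span_sections i ▸ Submodule.mem_top
    have hw : w ∈ Submodule.span K[T;T⁻¹] (F.sections i : Set F.Overlap) :=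
      F.span_sections i ▸ Submodule.mem_top
    change v ⊗ₜ[K[T;T⁻¹]] w ∈ Submodule.span K[T;T⁻¹] _
    induction hv using Submodule.span_induction with
    | mem v hv =>
      induction hw using Submodule.span_induction with
      | mem w hw => exact Submodule.subset_span ⟨v, hv, w, hw, rfl⟩
      | zero => rw [tmul_zero]; exact zero_mem _
      | add x y _ _ hx hy => rw [tmul_add]; exact add_mem hx hy
      | smul a x _ hx => rw [tmul_smul]; exact Submodule.smul_mem _ _ hx
    | zero => rw [zero_tmul]; exact zero_mem _
    | add x y _ _ hx hy => rw [add_tmul]; exact add_mem hx hy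
    | smul a x _ hx => rw [← smul_tmul']; exact Submodule.smul_mem _ _ hx

theorem finite (E : VectorBundle K) : Module.Finite K[T;T⁻¹] E.Overlap := by
  obtain ⟨s, hs⟩ := E.sections_fg 0
  refine ⟨⟨s, ?_⟩⟩
  rw [← E.span_sections 0, ← hs, Submodule.span_span_of_tower]

/-- The sections over chart `i` of the dual of `E`: the linear forms that map the sections of `E`
over chart `i` to functions on chart `i`. -/
def dualSections (E : VectorBundle K) (i : Fin 2) :
    Submodule (chartRing K i) (Module.Dual K[T;T⁻¹] E.Overlap) where
  carrier := {f | ∀ v ∈ E.sections i, f v ∈ chartRing K i}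
  add_mem' := fun hf hg v hv => add_mem (hf v hv) (hg v hv)
  zero_mem' := fun _ _ => zero_mem _
  smul_mem' := fun c _ hf v hv => mul_mem c.2 (hf v hv)

/-- The dual of a vector bundle. -/
def dual (E : VectorBundle K) : VectorBundle K where
  Overlap := Module.Dual K[T;T⁻¹] E.Overlap
  projective := by
    have := E.projective
    have := E.finite
    infer_instance
  sections := E.dualSections
  sections_fg i := by
    obtain ⟨s, hs⟩ := E.sections_fg i
    rw [← Module.Finite.iff_fg]
    have hmem : ∀ g : s, (g : E.Overlap) ∈ E.sections i := fun g => hs ▸ Submodule.subset_span g.2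
    let ev : E.dualSections i →ₗ[chartRing K i] (s → chartRing K i) :=
      { toFun := fun f g => ⟨f.1 g, f.2 g (hmem g)⟩
        map_add' := fun _ _ => rfl
        map_smul' := fun _ _ => rfl }
    refine Module.Finite.of_injective ev ?_
    intro f f' h
    apply Subtype.ext
    refine LinearMap.ext_on (s := (s : Set E.Overlap)) ?_ ?_
    · rw [← E.span_sections i, ← hs, Submodule.span_span_of_tower]
    · intro g hg
      exact congrArg Subtype.val (congrFun h ⟨g, hg⟩)
  span_sections i := by
    obtain ⟨s, hs⟩ := E.sections_fg i
    rw [eq_top_iff]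
    intro f _
    choose m hm using fun g : E.Overlap => exists_T_mul_mem i (f g)
    let d : ℤ := (![1, -1] : Fin 2 → ℤ) i * (s.sup m : ℕ)
    have hf : f = (T (-d) : K[T;T⁻¹]) • ((T d : K[T;T⁻¹]) • f) := by
      rw [smul_smul, ← T_add, neg_add_cancel, T_zero, one_smul]
    rw [hf]
    refine Submodule.smul_mem _ _ (Submodule.subset_span ?_)
    intro v hv
    rw [← hs] at hv
    induction hv using Submodule.span_induction with
    | mem g hg => exact hm g _ (Finset.le_sup hg)
    | zero => rw [map_zero]; exact zero_mem _
    | add x y _ _ hx hy => rw [map_add]; exact add_mem hx hy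
    | smul a x _ hx =>
      have h : ((T d : K[T;T⁻¹]) • f) (a • x) = (a : K[T;T⁻¹]) * ((T d : K[T;T⁻¹]) • f) x :=
        map_smul ((T d : K[T;T⁻¹]) • f) (a : K[T;T⁻¹]) x
      rw [h]
      exact mul_mem a.2 hx

end VectorBundle

namespace Morphism

variable {r n : ℕ} (φ : Morphism K r n)

/-- The restriction of `φ` to the overlap of the two charts. -/
def onOverlap : Module.Grassmannian K[T;T⁻¹] (Fin n → K[T;T⁻¹]) (n - r) :=
  pointMap (chartHom K 0).toRingHom (φ.onChart 0)

theorem pointMap_onChart (i : Fin 2) :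
    pointMap (chartHom K i).toRingHom (φ.onChart i) = φ.onOverlap := by
  fin_cases i
  · rfl
  · exact φ.agree.symm

/-- The sections over chart `i` of `φ^* 𝒮`, as a submodule of the sections of `𝒪 ^ n` over the
overlap. -/
def chartSections (i : Fin 2) : Submodule (chartRing K i) (Fin n → K[T;T⁻¹]) :=
  Submodule.span (chartRing K i)
    ((fun v : Fin n → K[X] => fun j => chartHom K i (v j)) '' (φ.onChart i).toSubmodule)

theorem span_chartSections (i : Fin 2) :
    Submodule.span K[T;T⁻¹] (φ.chartSections i : Set (Fin n → K[T;T⁻¹])) =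
      φ.onOverlap.toSubmodule := by
  rw [chartSections, Submodule.span_span_of_tower, ← φ.pointMap_onChart i]
  rfl

theorem chartSections_fg (i : Fin 2) : (φ.chartSections i).FG := by
  obtain ⟨s, hs⟩ := IsNoetherian.noetherian (φ.onChart i).toSubmodule
  refine Submodule.fg_def.2
    ⟨(fun v : Fin n → K[X] => fun j => chartHom K i (v j)) '' s, s.finite_toSet.image _, ?_⟩
  apply le_antisymm
  · refine Submodule.span_mono (Set.image_mono ?_)
    rw [← hs]
    exact Submodule.subset_span
  · refine Submodule.span_le.2 ?_
    rintro _ ⟨v, hv, rfl⟩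
    rw [SetLike.mem_coe, ← hs] at hv
    change (fun j => chartHom K i (v j)) ∈ Submodule.span (chartRing K i) _
    induction hv using Submodule.span_induction with
    | mem v hv => exact Submodule.subset_span ⟨v, hv, rfl⟩
    | zero =>
      simp only [Pi.zero_apply, map_zero]
      exact zero_mem (Submodule.span (chartRing K i) _)
    | add x y _ _ hx hy => simpa using! add_mem hx hy
    | smul a x _ hx =>
      simpa using! Submodule.smul_mem _ (⟨chartHom K i a, a, rfl⟩ : chartRing K i) hx

/-- The pullback `φ^* 𝒮` of the universal subbundle `𝒮 ⊆ 𝒪 ^ n`. -/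
def sub : VectorBundle K where
  Overlap := φ.onOverlap.toSubmodule
  projective := by
    have := φ.onOverlap.projective_quotient
    obtain ⟨t, ht⟩ := Module.projective_lifting_property φ.onOverlap.toSubmodule.mkQ LinearMap.id
      (Submodule.mkQ_surjective _)
    have hmem : ∀ x, (LinearMap.id (R := K[T;T⁻¹]) - t ∘ₗ φ.onOverlap.toSubmodule.mkQ :
          (Fin n → K[T;T⁻¹]) →ₗ[K[T;T⁻¹]] (Fin n → K[T;T⁻¹])) x
        ∈ φ.onOverlap.toSubmodule := fun x => by
      rw [← Submodule.Quotient.mk_eq_zero, ← Submodule.mkQ_apply]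
      have h := LinearMap.congr_fun ht (φ.onOverlap.toSubmodule.mkQ x)
      rw [LinearMap.sub_apply, map_sub, sub_eq_zero]
      exact h.symm
    refine Module.Projective.of_split φ.onOverlap.toSubmodule.subtype
      (LinearMap.codRestrict _ _ hmem) ?_
    ext x : 2
    have h : φ.onOverlap.toSubmodule.mkQ (x : Fin n → K[T;T⁻¹]) = 0 := by simp
    simp only [LinearMap.comp_apply, LinearMap.codRestrict_apply, LinearMap.sub_apply,
      Submodule.subtype_apply, LinearMap.id_apply, h, map_zero, sub_zero]
  sections i := (φ.chartSections i).comap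
    (φ.onOverlap.toSubmodule.subtype.restrictScalars (chartRing K i))
  sections_fg i := by
    refine Submodule.fg_of_fg_map_injective
      (φ.onOverlap.toSubmodule.subtype.restrictScalars (chartRing K i)) Subtype.val_injective ?_
    rw [Submodule.map_comap_eq_self]
    · exact φ.chartSections_fg i
    · intro x hx
      exact ⟨⟨x, φ.span_chartSections i ▸ Submodule.subset_span hx⟩, rfl⟩
  span_sections i := by
    apply Submodule.map_injective_of_injective φ.onOverlap.toSubmodule.injective_subtype
    rw [Submodule.map_span, Submodule.map_top, Submodule.range_subtype]
    refine Eq.trans ?_ (φ.span_chartSections i)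
    congr 1
    ext x
    constructor
    · rintro ⟨y, hy, rfl⟩
      exact hy
    · intro hx
      exact ⟨⟨x, φ.span_chartSections i ▸ Submodule.subset_span hx⟩, hx, rfl⟩

/-- The pullback `φ^* 𝒬` of the universal quotient bundle `𝒬 = 𝒪 ^ n / 𝒮`: over each chart it is
generated by the images of the standard basis of `𝒪 ^ n`. -/
def quot : VectorBundle K where
  Overlap := (Fin n → K[T;T⁻¹]) ⧸ φ.onOverlap.toSubmodule
  projective := φ.onOverlap.projective_quotient
  sections i := Submodule.span (chartRing K i)
    (Set.range fun j : Fin n => φ.onOverlap.toSubmodule.mkQ (Pi.single j 1))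
  sections_fg i := Submodule.fg_span (Set.finite_range _)
  span_sections i := by
    have h := (Pi.basisFun K[T;T⁻¹] (Fin n)).span_eq
    have h' := congrArg (Submodule.map φ.onOverlap.toSubmodule.mkQ) h
    rw [Submodule.map_span, ← Set.range_comp, Submodule.map_top, Submodule.range_mkQ] at h'
    rw [Submodule.span_span_of_tower, ← h']
    congr 2
    ext j
    simp

/-- The pullback `φ^* T_G ≅ φ^* 𝒮^* ⊗ φ^* 𝒬` of the tangent bundle of `G = G(r, n)`. -/
def tangent : VectorBundle K := φ.sub.dual.tensor φ.quot

end Morphism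

end Bundles

/-! ### The loci -/

section Loci

/-- The `K`-points of `Mor_e(ℙ¹, G(r, n))`, with the Zariski topology: the degree of `φ` is the
degree of `φ^* 𝒮^*`. -/
abbrev Mor (K : Type u) [Field K] (e r n : ℕ) : Type u :=
  {φ : Morphism K r n // φ.sub.dual.HasDegree e}

variable (K : Type u) [Field K] (e r n : ℕ)

/-- `M(b)`: the restricted universal quotient bundle has splitting type `b`. -/
def quotLocus (b : Fin (n - r) → ℤ) : Set (Mor K e r n) :=
  {φ | φ.1.quot.HasSplittingType b}

/-- `M'(a)`: the dual of the restricted universal subbundle has splitting type `a`. -/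
def subLocus (a : Fin r → ℤ) : Set (Mor K e r n) :=
  {φ | φ.1.sub.dual.HasSplittingType a}

/-- The restricted tangent bundle has splitting type `c`. -/
def tangentLocus (c : Fin (r * (n - r)) → ℤ) : Set (Mor K e r n) :=
  {φ | φ.1.tangent.HasSplittingType c}

variable {r n}

/-- `A` is a filling for `c`: its entries are the `c l`, each used once, its rows and columns are
increasing, and the difference of two rows (of two columns) is constant. -/
structure IsFilling (c : Fin (r * (n - r)) → ℤ) (A : Matrix (Fin r) (Fin (n - r)) ℤ) : Prop where
  entries : ∃ l : Fin r × Fin (n - r) ≃ Fin (r * (n - r)), ∀ i j, A i j = c (l (i, j))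
  column_increasing : ∀ j, Monotone fun i => A i j
  row_increasing : ∀ i, Monotone fun j => A i j
  row_difference : ∀ i i' j j', A i' j - A i j = A i' j' - A i j'
  column_difference : ∀ j j' i i', A i j' - A i j = A i' j' - A i' j

/-- `a` and `b` are the non-negative increasing splitting types in degree `e` that arise from the
matrix `A`. -/
structure ArisesFrom (A : Matrix (Fin r) (Fin (n - r)) ℤ) (a : Fin r → ℤ)
    (b : Fin (n - r) → ℤ) : Prop where
  a_nonneg : ∀ i, 0 ≤ a i
  a_increasing : Monotone a
  b_nonneg : ∀ j, 0 ≤ b j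
  b_increasing : Monotone b
  degree_eq : (e : ℚ) = 1 / (n : ℚ) * ∑ i, ∑ j, (A i j : ℚ)
  a_eq : ∀ i, (a i : ℚ) = 1 / ((n : ℚ) - r) * (∑ j, (A i j : ℚ) - e)
  b_eq : ∀ j, (b j : ℚ) = 1 / (r : ℚ) * (∑ i, (A i j : ℚ) - e)

/-- The fillings of `c` that give rise to splitting types in degree `e`, with these types. -/
structure SplitFilling (c : Fin (r * (n - r)) → ℤ) where
  A : Matrix (Fin r) (Fin (n - r)) ℤ
  a : Fin r → ℤ
  b : Fin (n - r) → ℤ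
  isFilling : IsFilling c A
  arises : ArisesFrom e A a b

end Loci

/-- `Z` is stratified by the sets `S i`: it is the disjoint union of these finitely many locally
closed sets, and the closure in `Z` of each of them is a union of some of them. -/
structure IsStratifiedBy {X : Type*} [TopologicalSpace X] {ι : Type*} (Z : Set X) (S : ι → Set X) :
    Prop where
  finite : Finite ι
  iUnion_eq : ⋃ i, S i = Z
  disjoint : Pairwise fun i j => Disjoint (S i) (S j)
  locallyClosed : ∀ i, IsLocallyClosed (S i)
  frontier : ∀ i j, (closure (S i) ∩ S j).Nonempty → S j ⊆ closure (S i)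

end GrassmannianCurves

end

noncomputable section

open LaurentPolynomial Polynomial TensorProduct

universe u v w

namespace GrassmannianCurves

/-! ### Laurent polynomials, the two chart rings and the twist of a line bundle. -/

section Laurent

variable {K : Type u} [Field K]

/-! Every bundle on the projective line splits, and its splitting type is unique up to order. If
`φ^* 𝒮^*` and `φ^* 𝒬` have types `a` and `b`, then the tangent pullback has type `a i + b j`. Since
`𝒮^*` and `𝒬` are globally generated of degree `e`, both types are non-negative with sum `e`.
Conversely, the conditions on a filling force `A i j = a i + b j` (`SplitFilling.facts`). Hence
fillings correspond to the pairs of increasing types whose sums are the `c l`, and uniqueness of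
splitting types gives the union and the disjointness.

Local closedness is semicontinuity. The numbers `∑ (m - a i)⁺` and `∑ (m - b j)⁺` are the dimensions
of the global sections of `φ^* 𝒮(m - 1)` and `φ^* 𝒬^*(m - 1)`. Both spaces consist of polynomial
vectors of degree less than `m` that solve linear equations varying with `φ`, so their dimensions
can only jump up on closed sets (`isClosed_le_finrank_subSolutions`,
`isClosed_le_finrank_quotSolutions`). The values for `m ≤ e` determine the types
(`IsType.eq_of_sum_toNat_eq`).

The frontier condition holds because a stratum of the tangent locus meets the closure of no other.
Summing the section numbers over `m ≤ e` gives half of `∑ a i ^ 2` plus a constant depending only on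
`e` and the rank. In the closure of a stratum each section number is at least its value on the
stratum, so neither sum of squares can drop. But `∑ c l ^ 2 = (n - r) ∑ a i ^ 2 + 2 e ^ 2 + r ∑ b j
^ 2` is the same on all strata, so neither can grow, and every section number agrees
(`IsType.eq_of_sum_toNat_le`). -/

theorem coeff_T_mul (d : ℤ) (f : K[T;T⁻¹]) (n : ℤ) : (T d * f).coeff n = f.coeff (n - d) := by
  have h := AddMonoidAlgebra.coeff_single_mul_apply f (1 : K) d n
  rw [one_mul] at h
  rw [T, h, neg_add_eq_sub]

theorem mem_chartRing_zero_iff {f : K[T;T⁻¹]} : f ∈ chartRing K 0 ↔ ∃ p : K[X], toLaurent p = f :=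
  Iff.rfl

theorem toLaurent_mem_chartRing (p : K[X]) : toLaurent p ∈ chartRing K 0 := ⟨p, rfl⟩

theorem coeff_toLaurent_natCast (p : K[X]) (d : ℕ) : (toLaurent p).coeff (d : ℤ) = p.coeff d := by
  rw [coeff_toLaurent]
  exact Finsupp.mapDomain_apply Nat.cast_injective _ _

/-- For the converse, a power `T ^ m` turns `f` into a polynomial; the vanishing of the negative
coefficients makes `X ^ m` divide it. -/
theorem mem_chartRing_zero_iff_coeff {f : K[T;T⁻¹]} :
    f ∈ chartRing K 0 ↔ ∀ n : ℤ, n < 0 → f.coeff n = 0 := by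
  constructor
  · rintro ⟨p, rfl⟩ n hn
    change (toLaurent p).coeff n = 0
    rw [← Finsupp.notMem_support_iff, support_coeff_toLaurent]
    simp only [Finset.mem_map, not_exists, not_and]
    intro m _ hm
    have : (m : ℤ) = n := hm
    omega
  · intro h
    obtain ⟨m, g, hg⟩ := exists_T_pow f
    have hd : (X ^ m : K[X]) ∣ g := by
      rw [Polynomial.X_pow_dvd_iff]
      intro d hd
      rw [← coeff_toLaurent_natCast, hg, ← T_mul, coeff_T_mul]
      exact h _ (by omega)
    obtain ⟨q, rfl⟩ := hd
    refine ⟨q, ?_⟩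
    change toLaurent q = f
    rw [map_mul, toLaurent_X_pow, ← T_mul] at hg
    exact (isUnit_T (R := K) (m : ℤ)).mul_left_cancel hg

theorem mem_chartRing_one_iff {f : K[T;T⁻¹]} : f ∈ chartRing K 1 ↔ invert f ∈ chartRing K 0 := by
  constructor
  · rintro ⟨p, rfl⟩
    exact ⟨p, (involutive_invert _).symm⟩
  · rintro ⟨p, hp⟩
    refine ⟨p, ?_⟩
    change invert (toLaurent p) = f
    exact (congrArg invert hp).trans (involutive_invert f)

theorem mem_chartRing_one_iff_coeff {f : K[T;T⁻¹]} :
    f ∈ chartRing K 1 ↔ ∀ n : ℤ, 0 < n → f.coeff n = 0 := by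
  rw [mem_chartRing_one_iff, mem_chartRing_zero_iff_coeff]
  simp only [LaurentPolynomial.invert_apply]
  exact ⟨fun h n hn => by simpa using h (-n) (by omega), fun h n hn => h _ (by omega)⟩

/-- The global sections of `𝒪(d)` are the polynomials of degree at most `d`. For negative `d`,
truncation by `toNat` leaves only zero, as it should. -/
theorem T_neg_mul_toLaurent_mem_iff (p : K[X]) (d : ℤ) :
    T (-d) * toLaurent p ∈ chartRing K 1 ↔ p ∈ Polynomial.degreeLT K (d + 1).toNat := by
  rw [mem_chartRing_one_iff_coeff, Polynomial.mem_degreeLT, Polynomial.degree_lt_iff_coeff_zero]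
  constructor
  · intro h m hm
    have := h (m - d) (by omega)
    rwa [coeff_T_mul, sub_neg_eq_add, sub_add_cancel, coeff_toLaurent_natCast] at this
  · intro h n hn
    rw [coeff_T_mul, sub_neg_eq_add]
    rcases lt_or_ge (n + d) 0 with h0 | h0
    · exact mem_chartRing_zero_iff_coeff.1 (toLaurent_mem_chartRing p) _ h0
    · obtain ⟨k, hk⟩ := Int.eq_ofNat_of_zero_le h0
      rw [hk]
      erw [coeff_toLaurent_natCast]
      exact h k (by omega)

theorem C_mem_chartRing (i : Fin 2) (c : K) : (LaurentPolynomial.C c : K[T;T⁻¹]) ∈ chartRing K i :=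
  (chartRing K i).algebraMap_mem c

/-- After clearing denominators, a unit and its inverse become polynomials whose product is a power
of the prime `X`. -/
theorem exists_C_mul_T_of_isUnit {f : K[T;T⁻¹]} (hf : IsUnit f) :
    ∃ (c : K) (d : ℤ), c ≠ 0 ∧ f = LaurentPolynomial.C c * T d := by
  obtain ⟨g, hg⟩ := hf.exists_right_inv
  obtain ⟨m, p, hp⟩ := exists_T_pow f
  obtain ⟨k, q, hq⟩ := exists_T_pow g
  have hpq : p * q = X ^ (m + k) := by
    rw [← toLaurent_inj, map_mul, hp, hq, toLaurent_X_pow, Nat.cast_add, T_add]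
    linear_combination (T (m : ℤ) * T (k : ℤ)) * hg
  obtain ⟨s, -, hs⟩ := (dvd_prime_pow Polynomial.prime_X _).1 (Dvd.intro _ hpq)
  obtain ⟨w, hw⟩ := hs.symm
  obtain ⟨c, hc, hc'⟩ := Polynomial.isUnit_iff.1 w.isUnit
  refine ⟨c, s - m, hc.ne_zero, ?_⟩
  rw [← hw, ← hc', map_mul, toLaurent_X_pow, toLaurent_C] at hp
  have h2 : f = f * T (m : ℤ) * T (-m : ℤ) := by rw [mul_T_assoc]; simp
  rw [h2, ← hp, sub_eq_add_neg, T_add]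
  ring

/-- The exponent `0` on chart `0` and `d` on chart `1`: the twist of the line bundle `𝒪(d)`. -/
def twist (d : ℤ) : Fin 2 → ℤ := ![0, d]

@[simp] theorem twist_at_zero (d : ℤ) : twist d 0 = 0 := rfl

@[simp] theorem twist_at_one (d : ℤ) : twist d 1 = d := rfl

theorem twist_add (d d' : ℤ) (i : Fin 2) : twist (d + d') i = twist d i + twist d' i := by
  fin_cases i <;> simp

theorem twist_neg (d : ℤ) (i : Fin 2) : twist (-d) i = -twist d i := by
  fin_cases i <;> simp

theorem T_neg_mul_T (d : ℤ) : (T (-d) * T d : K[T;T⁻¹]) = 1 := by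
  rw [← T_add, neg_add_cancel, T_zero]

end Laurent

/-! ### Frames: overlap bases that split the sections over both charts. -/

section Frames

variable {K : Type u} [Field K] {V : Type v} [AddCommGroup V] [Module K[T;T⁻¹] V]
  {W : Type w} [AddCommGroup W] [Module K[T;T⁻¹] W]
  {S : ∀ i : Fin 2, Submodule (chartRing K i) V} {S' : ∀ i : Fin 2, Submodule (chartRing K i) W}

theorem chart_smul_mem {i : Fin 2} {f : K[T;T⁻¹]} (hf : f ∈ chartRing K i)
    {x : V} (hx : x ∈ S i) : f • x ∈ S i :=
  (S i).smul_mem (⟨f, hf⟩ : chartRing K i) hx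

/-- A basis over the overlap that is adapted to the sections over the charts: `v j` generates
a summand `𝒪(a j)`. -/
def IsFrame (S : ∀ i : Fin 2, Submodule (chartRing K i) V) {ι : Type*} (a : ι → ℤ)
    (v : Module.Basis ι K[T;T⁻¹] V) : Prop :=
  ∀ i x, x ∈ S i ↔ ∀ j, T (-twist (a j) i) * v.repr x j ∈ chartRing K i

theorem IsFrame.smul_mem {ι : Type*} {a : ι → ℤ} {v : Module.Basis ι K[T;T⁻¹] V}
    (hv : IsFrame S a v) (i : Fin 2) (j : ι) : (T (twist (a j) i) : K[T;T⁻¹]) • v j ∈ S i := by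
  classical
  rw [hv]
  intro k
  rw [map_smul, Finsupp.smul_apply, v.repr_self, Finsupp.single_apply, smul_eq_mul, mul_ite,
    mul_one, mul_zero]
  split_ifs with h
  · subst h
    rw [T_neg_mul_T]
    exact one_mem _
  · rw [mul_zero]
    exact zero_mem _

theorem isFrame_of_smul_mem {ι : Type*} [Fintype ι] {a : ι → ℤ} {v : Module.Basis ι K[T;T⁻¹] V}
    (h1 : ∀ i j, (T (twist (a j) i) : K[T;T⁻¹]) • v j ∈ S i)
    (h2 : ∀ i, ∀ x ∈ S i, ∀ j, T (-twist (a j) i) * v.repr x j ∈ chartRing K i) :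
    IsFrame S a v := by
  refine fun i x => ⟨h2 i x, fun h => ?_⟩
  rw [← v.sum_repr x]
  refine Submodule.sum_mem _ fun j _ => ?_
  have := chart_smul_mem (h j) (h1 i j)
  rwa [smul_smul, mul_right_comm, T_neg_mul_T, one_mul] at this

theorem isFrame_of_span {ι : Type*} [Fintype ι] {a : ι → ℤ} {v : Module.Basis ι K[T;T⁻¹] V}
    (h : ∀ i, S i = Submodule.span (chartRing K i)
      (Set.range fun j => (T (twist (a j) i) : K[T;T⁻¹]) • v j)) : IsFrame S a v := by
  classical
  refine isFrame_of_smul_mem (fun i j => h i ▸ Submodule.subset_span ⟨j, rfl⟩) fun i x hx j => ?_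
  rw [h i] at hx
  induction hx using Submodule.span_induction with
  | mem x hx =>
    obtain ⟨k, rfl⟩ := hx
    dsimp only
    rw [map_smul, Finsupp.smul_apply, v.repr_self, Finsupp.single_apply, smul_eq_mul, mul_ite,
      mul_one, mul_zero]
    split_ifs with h
    · subst h
      rw [T_neg_mul_T]
      exact one_mem _
    · rw [mul_zero]
      exact zero_mem _
  | zero => rw [map_zero, Finsupp.zero_apply, mul_zero]; exact zero_mem _
  | add x y _ _ hx hy => rw [map_add, Finsupp.add_apply, mul_add]; exact add_mem hx hy
  | smul c x _ hx =>
    have h1 : v.repr (c • x) = (c : K[T;T⁻¹]) • v.repr x := map_smul v.repr (c : K[T;T⁻¹]) x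
    rw [h1, Finsupp.smul_apply, smul_eq_mul, mul_left_comm]
    exact mul_mem c.2 hx

theorem IsFrame.map {ι : Type*} {a : ι → ℤ} {v : Module.Basis ι K[T;T⁻¹] V}
    (hv : IsFrame S a v) (g : V ≃ₗ[K[T;T⁻¹]] W) (h : ∀ i x, x ∈ S i ↔ g x ∈ S' i) :
    IsFrame S' a (v.map g) := by
  intro i x
  have := (h i (g.symm x)).symm.trans (hv i (g.symm x))
  rwa [g.apply_symm_apply] at this

theorem IsFrame.reindex {ι κ : Type*} {a : ι → ℤ} {v : Module.Basis ι K[T;T⁻¹] V}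
    (hv : IsFrame S a v) (e : ι ≃ κ) : IsFrame S (a ∘ e.symm) (v.reindex e) := by
  intro i x
  rw [hv, ← e.symm.forall_congr_right]
  simp

theorem IsFrame.tensor {ι κ : Type*} [Fintype ι] [Fintype κ] {a : ι → ℤ} {b : κ → ℤ}
    {v : Module.Basis ι K[T;T⁻¹] V} {w : Module.Basis κ K[T;T⁻¹] W}
    (hv : IsFrame S a v) (hw : IsFrame S' b w) :
    IsFrame (fun i => Submodule.span (chartRing K i)
      {x | ∃ v ∈ S i, ∃ w ∈ S' i, v ⊗ₜ[K[T;T⁻¹]] w = x})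
      (fun p : ι × κ => a p.1 + b p.2) (v.tensorProduct w) := by
  refine isFrame_of_smul_mem ?_ ?_
  · rintro i ⟨j, k⟩
    refine Submodule.subset_span ⟨_, hv.smul_mem i j, _, hw.smul_mem i k, ?_⟩
    rw [Module.Basis.tensorProduct_apply, TensorProduct.smul_tmul_smul, twist_add, T_add]
  · rintro i x hx ⟨j, k⟩
    induction hx using Submodule.span_induction with
    | mem x hx =>
      obtain ⟨y, hy, z, hz, rfl⟩ := hx
      have h1 := mul_mem ((hv i y).1 hy j) ((hw i z).1 hz k)
      rw [Module.Basis.tensorProduct_repr_tmul_apply, twist_add, neg_add, T_add]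
      convert! h1 using 1
      rw [smul_eq_mul]
      ring
    | zero => rw [map_zero, Finsupp.zero_apply, mul_zero]; exact zero_mem _
    | add x y _ _ hx hy => rw [map_add, Finsupp.add_apply, mul_add]; exact add_mem hx hy
    | smul c x _ hx =>
      have h1 : (v.tensorProduct w).repr (c • x) = (c : K[T;T⁻¹]) • (v.tensorProduct w).repr x :=
        map_smul (v.tensorProduct w).repr (c : K[T;T⁻¹]) x
      rw [h1, Finsupp.smul_apply, smul_eq_mul, mul_left_comm]
      exact mul_mem c.2 hx

theorem isFrame_piBasisFun {ι : Type*} [Fintype ι] [DecidableEq ι] (a : ι → ℤ) :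
    IsFrame (fun i => Submodule.span (chartRing K i)
      (Set.range fun j => (Pi.single j (T (twist (a j) i)) : ι → K[T;T⁻¹]))) a
      (Pi.basisFun K[T;T⁻¹] ι) := by
  refine isFrame_of_span fun i => ?_
  congr 2
  funext j
  rw [Pi.basisFun_apply, ← Pi.single_smul', smul_eq_mul, mul_one]

end Frames

/-! ### Splitting types in terms of frames, with duals and tensor products. -/

namespace VectorBundle

variable {K : Type u} [Field K] {E F : VectorBundle K}

variable (E) in
/-- `E ≅ ⨁ j, 𝒪(a j)` for a family `a` indexed by any type. -/
def HasFrame {ι : Type*} (a : ι → ℤ) : Prop :=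
  ∃ v : Module.Basis ι K[T;T⁻¹] E.Overlap, IsFrame E.sections a v

theorem hasFrame_sumLineBundles {m : ℕ} (a : Fin m → ℤ) :
    (sumLineBundles (K := K) a).HasFrame a :=
  ⟨Pi.basisFun K[T;T⁻¹] (Fin m), isFrame_piBasisFun a⟩

theorem hasSplittingType_iff {m : ℕ} {a : Fin m → ℤ} : E.HasSplittingType a ↔ E.HasFrame a := by
  constructor
  · rintro ⟨g, hg⟩
    obtain ⟨v, hv⟩ := hasFrame_sumLineBundles (K := K) a
    refine ⟨v.map g.symm, hv.map g.symm fun i x => ?_⟩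
    rw [hg, g.apply_symm_apply]
  · rintro ⟨v, hv⟩
    refine ⟨v.equivFun, fun i x => ?_⟩
    exact (hv i x).trans (isFrame_piBasisFun a i (v.equivFun x)).symm

theorem HasFrame.reindex {ι κ : Type*} {a : ι → ℤ} (h : E.HasFrame a) (e : ι ≃ κ) :
    E.HasFrame (a ∘ e.symm) := by
  obtain ⟨v, hv⟩ := h
  exact ⟨_, hv.reindex e⟩

theorem HasFrame.dual {ι : Type*} [Fintype ι] {a : ι → ℤ} (h : E.HasFrame a) :
    E.dual.HasFrame (fun j => -a j) := by
  classical
  obtain ⟨v, hv⟩ := h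
  refine ⟨(v.dualBasis : Module.Basis ι K[T;T⁻¹] (Module.Dual K[T;T⁻¹] E.Overlap)), ?_⟩
  change IsFrame (V := Module.Dual K[T;T⁻¹] E.Overlap) E.dualSections _ v.dualBasis
  intro i f
  change (∀ x ∈ E.sections i, f x ∈ chartRing K i) ↔ _
  simp only [v.dualBasis_repr, twist_neg, neg_neg]
  constructor
  · intro h j
    have := h _ (hv.smul_mem i j)
    rwa [map_smul, smul_eq_mul] at this
  · intro h x hx
    rw [← v.sum_repr x, map_sum]
    refine sum_mem fun j _ => ?_
    have h1 := mul_mem ((hv i x).1 hx j) (h j)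
    rw [map_smul, smul_eq_mul]
    have h2 : T (-twist (a j) i) * v.repr x j * (T (twist (a j) i) * f (v j)) =
        (T (-twist (a j) i) * T (twist (a j) i)) * (v.repr x j * f (v j)) := by ring
    rwa [h2, T_neg_mul_T, one_mul] at h1

theorem HasFrame.tensor {ι κ : Type*} [Fintype ι] [Fintype κ] {a : ι → ℤ} {b : κ → ℤ}
    (hE : E.HasFrame a) (hF : F.HasFrame b) :
    (E.tensor F).HasFrame (fun p : ι × κ => a p.1 + b p.2) := by
  obtain ⟨v, hv⟩ := hE
  obtain ⟨w, hw⟩ := hF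
  exact ⟨v.tensorProduct w, hv.tensor hw⟩

end VectorBundle

/-! ### Dimensions of spaces of sections, and uniqueness of the splitting type. -/

section Counting

variable {K : Type u} [Field K]

theorem finrank_map_of_injective {V W : Type*} [AddCommGroup V] [Module K V] [AddCommGroup W]
    [Module K W] (f : V →ₗ[K] W) (hf : Function.Injective f) (p : Submodule K V) :
    Module.finrank K (p.map f) = Module.finrank K p :=
  (LinearEquiv.finrank_eq (Submodule.equivMapOfInjective f hf p)).symm

/-- The global sections of `⨁ j, 𝒪(k + a j)` as a subspace of the sections over the overlap. -/
def twistedSections {ι : Type*} (a : ι → ℤ) (k : ℤ) : Submodule K (ι → K[T;T⁻¹]) where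
  carrier := {x | ∀ j, x j ∈ chartRing K 0 ∧ T (-(k + a j)) * x j ∈ chartRing K 1}
  add_mem' hx hy j := ⟨add_mem (hx j).1 (hy j).1, by
    rw [Pi.add_apply, mul_add]; exact add_mem (hx j).2 (hy j).2⟩
  zero_mem' j := ⟨zero_mem _, by rw [Pi.zero_apply, mul_zero]; exact zero_mem _⟩
  smul_mem' c x hx j := ⟨Subalgebra.smul_mem _ (hx j).1 c, by
    rw [Pi.smul_apply, mul_smul_comm]; exact Subalgebra.smul_mem _ (hx j).2 c⟩

theorem finrank_twistedSections {ι : Type*} [Fintype ι] (a : ι → ℤ) (k : ℤ) :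
    Module.finrank K (twistedSections (K := K) a k) = ∑ j, (k + a j + 1).toNat := by
  let f : (∀ j, Polynomial.degreeLT K (k + a j + 1).toNat) →ₗ[K] (ι → K[T;T⁻¹]) :=
    LinearMap.pi fun j => toLaurentAlg.toLinearMap ∘ₗ
      (Polynomial.degreeLT K (k + a j + 1).toNat).subtype ∘ₗ LinearMap.proj j
  have hf : Function.Injective f := by
    intro p q h
    funext j
    exact Subtype.ext (toLaurent_injective (congrFun h j))
  have hr : LinearMap.range f = twistedSections a k := by
    ext x
    constructor
    · rintro ⟨p, rfl⟩ j
      exact ⟨toLaurent_mem_chartRing _, (T_neg_mul_toLaurent_mem_iff _ _).2 (p j).2⟩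
    · intro h
      choose p hp using fun j => mem_chartRing_zero_iff.1 (h j).1
      refine ⟨fun j => ⟨p j, (T_neg_mul_toLaurent_mem_iff _ _).1 ?_⟩, funext hp⟩
      rw [hp]
      exact (h j).2
  rw [← hr, LinearMap.finrank_range_of_inj hf, Module.finrank_pi_fintype]
  refine Finset.sum_congr rfl fun j _ => ?_
  rw [(Polynomial.degreeLTEquiv K _).finrank_eq, Module.finrank_fin_fun]

variable {V : Type v} [AddCommGroup V] [Module K[T;T⁻¹] V]
  {S : ∀ i : Fin 2, Submodule (chartRing K i) V}

theorem IsFrame.mem_twistedSections {ι : Type*} [Fintype ι] {a : ι → ℤ} {v : Module.Basis ι K[T;T⁻¹] V}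
    (hv : IsFrame S a v) (k : ℤ) (x : V) :
    v.equivFun x ∈ twistedSections (K := K) a k ↔ x ∈ S 0 ∧ (T (-k) : K[T;T⁻¹]) • x ∈ S 1 := by
  rw [hv, hv, ← forall_and]
  refine forall_congr' fun j => ?_
  rw [map_smul, Finsupp.smul_apply, smul_eq_mul, ← mul_assoc, ← T_add, twist_at_zero,
    twist_at_one, neg_zero, T_zero, one_mul, ← neg_add_rev, v.equivFun_apply]

/-- The second difference of `x ↦ max x 0` is the indicator function of one point. -/
theorem card_fiber_eq {ι : Type*} [Fintype ι] (a : ι → ℤ) (c : ℤ) :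
    (Fintype.card {j // a j = c} : ℤ) =
      ((∑ j, (-c + a j + 1).toNat : ℕ) : ℤ) + ((∑ j, (-c - 2 + a j + 1).toNat : ℕ) : ℤ) -
        2 * ((∑ j, (-c - 1 + a j + 1).toNat : ℕ) : ℤ) := by
  rw [Fintype.card_subtype, Finset.card_filter]
  push_cast
  rw [Finset.mul_sum, ← Finset.sum_add_distrib, ← Finset.sum_sub_distrib]
  refine Finset.sum_congr rfl fun j _ => ?_
  split_ifs <;> omega

theorem exists_equiv_of_sum_toNat_eq {ι κ : Type*} [Fintype ι] [Fintype κ] {a : ι → ℤ} {b : κ → ℤ}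
    (h : ∀ k : ℤ, ∑ j, (k + a j + 1).toNat = ∑ j, (k + b j + 1).toNat) :
    ∃ e : ι ≃ κ, ∀ j, b (e j) = a j := by
  have hcard : ∀ c : ℤ, Nonempty ({j // a j = c} ≃ {j // b j = c}) := by
    intro c
    rw [← Fintype.card_eq]
    have h1 := card_fiber_eq a c
    rw [h, h, h, ← card_fiber_eq b c] at h1
    exact_mod_cast h1
  exact ⟨Equiv.ofFiberEquiv fun c => (hcard c).some, Equiv.ofFiberEquiv_map _⟩

/-- The global sections of each twist are defined without a frame, so both families have the same
section numbers, and these recover all multiplicities. -/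
theorem IsFrame.exists_equiv {ι κ : Type*} [Fintype ι] [Fintype κ] {a : ι → ℤ} {b : κ → ℤ}
    {v : Module.Basis ι K[T;T⁻¹] V} {w : Module.Basis κ K[T;T⁻¹] V}
    (hv : IsFrame S a v) (hw : IsFrame S b w) : ∃ e : ι ≃ κ, ∀ j, b (e j) = a j := by
  refine exists_equiv_of_sum_toNat_eq fun k => ?_
  rw [← finrank_twistedSections (K := K), ← finrank_twistedSections (K := K)]
  let g : (ι → K[T;T⁻¹]) ≃ₗ[K] (κ → K[T;T⁻¹]) :=
    (v.equivFun.symm.trans w.equivFun).restrictScalars K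
  have : twistedSections b k = (twistedSections a k).map (g : (ι → K[T;T⁻¹]) →ₗ[K] _) := by
    ext x
    rw [Submodule.mem_map_equiv]
    have h1 := hv.mem_twistedSections k (w.equivFun.symm x)
    have h2 := hw.mem_twistedSections k (w.equivFun.symm x)
    rw [← h1, LinearEquiv.apply_symm_apply] at h2
    exact h2
  rw [this, LinearEquiv.finrank_map_eq]

/-- The vectors of polynomials of degree less than `m` that are orthogonal to `Γ`. -/
def solutions {n : ℕ} (Γ : Set (Fin n → K[X])) (m : ℕ) : Submodule K (Fin n → K[X]) where
  carrier := {x | (∀ j, x j ∈ Polynomial.degreeLT K m) ∧ ∀ γ ∈ Γ, ∑ j, γ j * x j = 0}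
  add_mem' hx hy := ⟨fun j => add_mem (hx.1 j) (hy.1 j), fun γ hγ => by
    simp only [Pi.add_apply, mul_add, Finset.sum_add_distrib, hx.2 γ hγ, hy.2 γ hγ, add_zero]⟩
  zero_mem' := ⟨fun j => zero_mem _, fun γ _ => by simp⟩
  smul_mem' c x hx := ⟨fun j => Submodule.smul_mem _ c (hx.1 j), fun γ hγ => by
    simp only [Pi.smul_apply, mul_smul_comm, ← Finset.smul_sum, hx.2 γ hγ, smul_zero]⟩

/-- A bundle embedded in `𝒪 ^ n` as a saturated subsheaf, cut out by equations `Γ`, has as sections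
of its twists polynomial solutions of bounded degree. This turns cohomology into linear algebra, and
it applies to both `𝒮` and `𝒬^*`. -/
theorem IsFrame.finrank_solutions {n : ℕ} {ι : Type*} [Fintype ι] {a : ι → ℤ}
    {v : Module.Basis ι K[T;T⁻¹] V} (hv : IsFrame S a v) (f : V →ₗ[K[T;T⁻¹]] (Fin n → K[T;T⁻¹]))
    (hf : Function.Injective f) (hS : ∀ i x, x ∈ S i ↔ ∀ j, f x j ∈ chartRing K i)
    {Γ : Set (Fin n → K[X])}
    (hΓ : ∀ y : Fin n → K[T;T⁻¹], y ∈ LinearMap.range f ↔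
      ∀ γ ∈ Γ, ∑ j, toLaurent (γ j) * y j = 0) (m : ℕ) :
    Module.finrank K (solutions Γ m) = ∑ j, (m + a j).toNat := by
  let t : (Fin n → K[X]) →ₗ[K] (Fin n → K[T;T⁻¹]) :=
    LinearMap.pi fun j => toLaurentAlg.toLinearMap ∘ₗ LinearMap.proj j
  have ht : Function.Injective t := fun x y h =>
    funext fun j => toLaurent_injective (congrFun h j)
  let g : (ι → K[T;T⁻¹]) →ₗ[K] (Fin n → K[T;T⁻¹]) :=
    (f ∘ₗ (v.equivFun.symm : (ι → K[T;T⁻¹]) →ₗ[K[T;T⁻¹]] V)).restrictScalars K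
  have hg : Function.Injective g := hf.comp v.equivFun.symm.injective
  have htapp : ∀ x, t x = fun j => toLaurent (x j) := fun _ => rfl
  have hgapp : ∀ z, g (v.equivFun z) = f z := fun z => congrArg f (v.equivFun.symm_apply_apply z)
  clear_value t g
  -- The twist is `m - 1` because degree less than `m` means degree at most `m - 1`.
  have key : (solutions Γ m).map t = (twistedSections a (m - 1)).map g := by
    ext y
    constructor
    · rintro ⟨x, ⟨hx1, hx2⟩, rfl⟩
      obtain ⟨z, hz⟩ := (hΓ (t x)).2 fun γ hγ => by
        have := congrArg toLaurent (hx2 γ hγ)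
        rw [map_sum, map_zero] at this
        rw [← this, htapp]
        exact Finset.sum_congr rfl fun j _ => (map_mul toLaurent _ _).symm
      refine ⟨v.equivFun z, (hv.mem_twistedSections _ z).2 ⟨?_, ?_⟩, ?_⟩
      · rw [hS, hz, htapp]
        exact fun j => toLaurent_mem_chartRing _
      · rw [hS, map_smul, hz, htapp]
        intro j
        rw [Pi.smul_apply, smul_eq_mul]
        refine (T_neg_mul_toLaurent_mem_iff _ _).2 ?_
        simpa using hx1 j
      · rw [hgapp, hz]
    · rintro ⟨c, hc, rfl⟩
      obtain ⟨z, rfl⟩ := v.equivFun.surjective c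
      obtain ⟨h0, h1⟩ := (hv.mem_twistedSections _ z).1 hc
      rw [hS] at h0 h1
      choose p hp using fun j => mem_chartRing_zero_iff.1 (h0 j)
      have htp : t p = f z := (htapp p).trans (funext hp)
      refine ⟨p, ⟨fun j => ?_, fun γ hγ => ?_⟩, ?_⟩
      · have h2 := h1 j
        rw [map_smul, Pi.smul_apply, smul_eq_mul, ← hp, T_neg_mul_toLaurent_mem_iff] at h2
        simpa using h2
      · apply toLaurent_injective
        rw [map_sum, map_zero, ← (hΓ (f z)).1 ⟨z, rfl⟩ γ hγ]
        exact Finset.sum_congr rfl fun j _ => by rw [map_mul, hp]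
      · rw [hgapp, htp]
  rw [← finrank_map_of_injective t ht, key, finrank_map_of_injective g hg, finrank_twistedSections]
  refine Finset.sum_congr rfl fun j _ => ?_
  congr 1
  ring

end Counting

/-! ### Grothendieck's splitting theorem by reduction of the transition matrix. -/

section Existence

variable {K : Type u} [Field K] {V : Type v} [AddCommGroup V] [Module K[T;T⁻¹] V]
  {S : ∀ i : Fin 2, Submodule (chartRing K i) V}

theorem chart_sum_smul_mem {i : Fin 2} {ι : Type*} (s : Finset ι) {c : ι → K[T;T⁻¹]} {x : ι → V}
    {N : Submodule (chartRing K i) V} (hc : ∀ j ∈ s, c j ∈ chartRing K i)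
    (hx : ∀ j ∈ s, x j ∈ N) : ∑ j ∈ s, c j • x j ∈ N :=
  Submodule.sum_mem _ fun j hj => N.smul_mem (⟨c j, hc j hj⟩ : chartRing K i) (hx j hj)

theorem T_mem_chartRing_one {d : ℤ} (hd : d ≤ 0) : (T d : K[T;T⁻¹]) ∈ chartRing K 1 := by
  rw [mem_chartRing_one_iff_coeff]
  intro n hn
  rw [T_apply, if_neg (by omega)]

/-- The end of the reduction: a transition matrix invertible over `K[X]` makes the `x j` a basis
over chart `0` as well, so they serve both charts. -/
theorem exists_isFrame_of_det_eq_C {ι : Type*} [Fintype ι] [DecidableEq ι] (B : Module.Basis ι K[T;T⁻¹] V)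
    (hB : S 0 = Submodule.span (chartRing K 0) (Set.range B)) (M : Matrix ι ι K[X])
    (x : ι → V) (hx : ∀ j, x j = ∑ i, toLaurent (M i j) • B i) (d : ι → ℤ)
    (h1 : S 1 = Submodule.span (chartRing K 1) (Set.range fun j => (T (d j) : K[T;T⁻¹]) • x j))
    (hM : IsUnit M.det) : ∃ v : Module.Basis ι K[T;T⁻¹] V, IsFrame S d v := by
  have hdet : IsUnit (M.map toLaurent).det := by
    have := hM.map (toLaurent (R := K))
    rwa [RingHom.map_det] at this
  let v := B.map (Matrix.toLinearEquiv B _ hdet)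
  have hv : ∀ j, v j = x j := by
    intro j
    rw [hx]
    change Matrix.toLin B B (M.map toLaurent) (B j) = _
    rw [Matrix.toLin_self]
    rfl
  refine ⟨v, isFrame_of_span fun i => ?_⟩
  simp only [hv]
  fin_cases i
  · change S 0 = Submodule.span (chartRing K 0) (Set.range fun j => (T 0 : K[T;T⁻¹]) • x j)
    simp only [T_zero, one_smul]
    rw [hB]
    apply le_antisymm
    · rw [Submodule.span_le]
      rintro _ ⟨k, rfl⟩
      have : B k = ∑ j, toLaurent (M⁻¹ j k) • x j := by
        simp only [hx, Finset.smul_sum, smul_smul]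
        rw [Finset.sum_comm]
        simp only [← Finset.sum_smul]
        have hi : ∀ i, ∑ j, toLaurent (M⁻¹ j k) * toLaurent (M i j) =
            toLaurent ((1 : Matrix ι ι K[X]) i k) := by
          intro i
          rw [← Matrix.mul_nonsing_inv M hM, Matrix.mul_apply, map_sum]
          exact Finset.sum_congr rfl fun j _ => by rw [map_mul, mul_comm]
        simp only [hi, Matrix.one_apply]
        rw [Finset.sum_eq_single k]
        · simp
        · intro i _ hik
          rw [if_neg hik, map_zero, zero_smul]
        · simp
      rw [this]
      exact chart_sum_smul_mem _ (fun j _ => toLaurent_mem_chartRing _)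
        fun j _ => Submodule.subset_span ⟨j, rfl⟩
    · rw [Submodule.span_le]
      rintro _ ⟨k, rfl⟩
      dsimp only
      rw [hx]
      exact chart_sum_smul_mem _ (fun j _ => toLaurent_mem_chartRing _)
        fun j _ => Submodule.subset_span ⟨j, rfl⟩
  · exact h1

/-- The determinant vanishes at `0`, so the columns are dependent there, and the same combination of
the columns of `M` is divisible by `X`. Putting the quotient in place of a column that occurs in the
relation removes one factor `X` from the determinant. Choosing that column with `d` minimal keeps
control of chart `1`. -/
theorem exists_column_operation {ι : Type*} [Fintype ι] [DecidableEq ι] {M : Matrix ι ι K[X]} (d : ι → ℤ)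
    {c : K} {s : ℕ} (hc : c ≠ 0) (hM : M.det = Polynomial.C c * X ^ (s + 1)) :
    ∃ (z : ι → K) (j₀ : ι) (q : ι → K[X]) (c' : K), z j₀ ≠ 0 ∧
      (∀ j, z j ≠ 0 → d j₀ ≤ d j) ∧ (∀ i, X * q i = ∑ j, Polynomial.C (z j) * M i j) ∧ c' ≠ 0 ∧
      (M.updateCol j₀ q).det = Polynomial.C c' * X ^ s := by
  have h0 : ((Polynomial.evalRingHom (0 : K)).mapMatrix M).det = 0 := by
    rw [← RingHom.map_det, hM]
    simp
  obtain ⟨z, hz, hz0⟩ := Matrix.exists_mulVec_eq_zero_iff.2 h0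
  obtain ⟨j₁, hj₁⟩ := Function.ne_iff.1 hz
  classical
  obtain ⟨j₀, hj₀, hmin⟩ := Finset.exists_min_image (Finset.univ.filter fun j => z j ≠ 0) d
    ⟨j₁, by simpa using hj₁⟩
  simp only [Finset.mem_filter, Finset.mem_univ, true_and] at hj₀ hmin
  have hdvd : ∀ i, (X : K[X]) ∣ ∑ j, Polynomial.C (z j) * M i j := by
    intro i
    rw [Polynomial.X_dvd_iff, Polynomial.coeff_zero_eq_eval_zero, Polynomial.eval_finsetSum]
    have := congrFun hz0 i
    rw [Pi.zero_apply, Matrix.mulVec, dotProduct] at this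
    refine Eq.trans ?_ this
    exact Finset.sum_congr rfl fun j _ => by simp [mul_comm]
  choose q hq using hdvd
  refine ⟨z, j₀, q, z j₀ * c, hj₀, hmin, fun i => (hq i).symm, mul_ne_zero hj₀ hc, ?_⟩
  have h1 := Matrix.det_updateCol_sum M j₀ fun j => Polynomial.C (z j)
  have h2 : (fun k => ∑ i, Polynomial.C (z i) • M k i) = (X : K[X]) • q := by
    funext k
    simp only [smul_eq_mul, Pi.smul_apply]
    exact hq k
  rw [h2, Matrix.det_updateCol_smul, hM] at h1
  refine mul_left_cancel₀ Polynomial.X_ne_zero (h1.trans ?_)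
  rw [smul_eq_mul, Polynomial.C_mul]
  ring

/-- Induction on the order of vanishing of the determinant: each column operation lowers it by one
and raises one twist by one. -/
theorem exists_isFrame_of_det_eq {ι : Type*} [Fintype ι] [DecidableEq ι] (B : Module.Basis ι K[T;T⁻¹] V)
    (hB : S 0 = Submodule.span (chartRing K 0) (Set.range B)) (s : ℕ) :
    ∀ (M : Matrix ι ι K[X]) (x : ι → V) (d : ι → ℤ) (c : K),
      (∀ j, x j = ∑ i, toLaurent (M i j) • B i) →
      S 1 = Submodule.span (chartRing K 1) (Set.range fun j => (T (d j) : K[T;T⁻¹]) • x j) →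
      c ≠ 0 → M.det = Polynomial.C c * X ^ s →
      ∃ (a : ι → ℤ) (v : Module.Basis ι K[T;T⁻¹] V),
        IsFrame S a v ∧ ∑ j, a j = ∑ j, d j + s := by
  induction s with
  | zero =>
    intro M x d c hx h1 hc hM
    obtain ⟨v, hv⟩ := exists_isFrame_of_det_eq_C B hB M x hx d h1 (by
      rw [hM, pow_zero, mul_one]
      exact Polynomial.isUnit_C.2 hc.isUnit)
    exact ⟨d, v, hv, by simp⟩
  | succ s ih =>
    intro M x d c hx h1 hc hM
    obtain ⟨z, j₀, q, c', hz, hmin, hq, hc', hM'⟩ := exists_column_operation d hc hM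
    set y : V := ∑ i, toLaurent (q i) • B i with hy
    have hTy : (T 1 : K[T;T⁻¹]) • y = ∑ j, (LaurentPolynomial.C (z j) : K[T;T⁻¹]) • x j := by
      simp only [hx, hy, Finset.smul_sum, smul_smul]
      rw [Finset.sum_comm]
      simp only [← Finset.sum_smul]
      refine Finset.sum_congr rfl fun i _ => ?_
      congr 1
      rw [← toLaurent_X, ← map_mul, hq, map_sum]
      exact Finset.sum_congr rfl fun j _ => by rw [map_mul, toLaurent_C]
    -- The new generator on chart `1` in terms of the old ones. By minimality of `d j₀` the
    -- coefficients lie in `K[T⁻¹]`, and the one at `j₀` is the nonzero constant `z j₀`, so the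
    -- exchange can be reversed.
    have hTy' : (T (d j₀ + 1) : K[T;T⁻¹]) • y =
        ∑ j, (LaurentPolynomial.C (z j) * T (d j₀ - d j) : K[T;T⁻¹]) •
          (T (d j) : K[T;T⁻¹]) • x j := by
      rw [T_add, mul_smul, hTy, Finset.smul_sum]
      refine Finset.sum_congr rfl fun j _ => ?_
      rw [smul_smul, smul_smul, mul_assoc, ← T_add, sub_add_cancel, mul_comm]
    have hcoef : ∀ j, (LaurentPolynomial.C (z j) * T (d j₀ - d j) : K[T;T⁻¹]) ∈ chartRing K 1 := by
      intro j
      by_cases hj : z j = 0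
      · rw [hj, map_zero, zero_mul]
        exact zero_mem _
      · exact mul_mem (C_mem_chartRing 1 _)
          (T_mem_chartRing_one (by linarith [hmin j hj]))
    have hx' : ∀ j, Function.update x j₀ y j = ∑ i, toLaurent (M.updateCol j₀ q i j) • B i := by
      intro j
      rcases eq_or_ne j j₀ with rfl | hj
      · simp [hy]
      · simp [hj, hx]
    have h1' : S 1 = Submodule.span (chartRing K 1) (Set.range fun j =>
        (T (Function.update d j₀ (d j₀ + 1) j) : K[T;T⁻¹]) • Function.update x j₀ y j) := by
      have hne : ∀ j, j ≠ j₀ → (T (Function.update d j₀ (d j₀ + 1) j) : K[T;T⁻¹]) •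
          Function.update x j₀ y j = (T (d j) : K[T;T⁻¹]) • x j := by
        intro j hj
        rw [Function.update_of_ne hj, Function.update_of_ne hj]
      have heq : (T (Function.update d j₀ (d j₀ + 1) j₀) : K[T;T⁻¹]) •
          Function.update x j₀ y j₀ = (T (d j₀ + 1) : K[T;T⁻¹]) • y := by
        rw [Function.update_self, Function.update_self]
      rw [h1]
      apply le_antisymm
      · rw [Submodule.span_le]
        rintro _ ⟨j, rfl⟩
        by_cases hj : j = j₀
        · subst hj
          rw [← Finset.add_sum_erase _ _ (Finset.mem_univ j), sub_self, T_zero, mul_one] at hTy'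
          have h2 : (T (d j) : K[T;T⁻¹]) • x j = (LaurentPolynomial.C (z j)⁻¹ : K[T;T⁻¹]) •
              ((T (d j + 1) : K[T;T⁻¹]) • y - ∑ k ∈ Finset.univ.erase j,
                (LaurentPolynomial.C (z k) * T (d j - d k) : K[T;T⁻¹]) •
                  (T (d k) : K[T;T⁻¹]) • x k) := by
            rw [hTy', add_sub_cancel_right, smul_smul, ← map_mul, inv_mul_cancel₀ hz, map_one,
              one_smul]
          change (T (d j) : K[T;T⁻¹]) • x j ∈ _
          rw [h2]
          refine Submodule.smul_mem _ (⟨_, C_mem_chartRing 1 _⟩ : chartRing K 1) ?_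
          refine sub_mem (Submodule.subset_span ⟨j, heq⟩) ?_
          exact chart_sum_smul_mem _ (fun k _ => hcoef k) fun k hk =>
            Submodule.subset_span ⟨k, hne k (Finset.ne_of_mem_erase hk)⟩
        · exact Submodule.subset_span ⟨j, hne j hj⟩
      · rw [Submodule.span_le]
        rintro _ ⟨j, rfl⟩
        by_cases hj : j = j₀
        · subst hj
          dsimp only
          rw [heq, hTy']
          exact chart_sum_smul_mem _ (fun k _ => hcoef k) fun k _ => Submodule.subset_span ⟨k, rfl⟩
        · dsimp only
          rw [hne j hj]
          exact Submodule.subset_span ⟨j, rfl⟩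
    obtain ⟨a, v, hv, ha⟩ := ih (M.updateCol j₀ q) (Function.update x j₀ y)
      (Function.update d j₀ (d j₀ + 1)) c' hx' h1' hc' hM'
    refine ⟨a, v, hv, ha.trans ?_⟩
    rw [Finset.sum_update_of_mem (Finset.mem_univ _),
      ← Finset.add_sum_erase _ d (Finset.mem_univ j₀), Finset.sdiff_singleton_eq_erase]
    push_cast
    ring

/-- Grothendieck's theorem, for a bundle of degree `D`. -/
theorem exists_isFrame_of_transition {ι : Type*} [Fintype ι] [DecidableEq ι] (B : Module.Basis ι K[T;T⁻¹] V)
    (hB : S 0 = Submodule.span (chartRing K 0) (Set.range B)) (x : ι → V)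
    (hx : S 1 = Submodule.span (chartRing K 1) (Set.range x))
    (M : Matrix ι ι K[T;T⁻¹]) (hM : ∀ j, x j = ∑ i, M i j • B i) {c : K} (hc : c ≠ 0)
    {D : ℤ} (hdet : M.det = LaurentPolynomial.C c * T D) :
    ∃ (a : ι → ℤ) (v : Module.Basis ι K[T;T⁻¹] V), IsFrame S a v ∧ ∑ j, a j = D := by
  -- One power `T ^ N₀` clears the denominators of all entries; the starting twist `-N₀` below
  -- compensates for it.
  choose N p hp using fun i j => exists_T_pow (M i j)
  let N₀ := Finset.univ.sup fun ij : ι × ι => N ij.1 ij.2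
  have hN : ∀ i j, N i j ≤ N₀ := fun i j =>
    Finset.le_sup (f := fun ij : ι × ι => N ij.1 ij.2) (Finset.mem_univ (i, j))
  let M' : Matrix ι ι K[X] := fun i j => p i j * X ^ (N₀ - N i j)
  have hM' : ∀ i j, toLaurent (M' i j) = T (N₀ : ℤ) * M i j := by
    intro i j
    rw [map_mul, hp, toLaurent_X_pow, mul_T_assoc, Nat.cast_sub (hN i j), add_sub_cancel, T_mul]
  have hdet' : toLaurent M'.det = LaurentPolynomial.C c * T (N₀ * Fintype.card ι + D) := by
    have : M'.map toLaurent = (T (N₀ : ℤ) : K[T;T⁻¹]) • M := by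
      ext1 i j
      exact hM' i j
    rw [RingHom.map_det, RingHom.mapMatrix_apply, this, Matrix.det_smul, hdet,
      T_pow, T_add, mul_comm (Fintype.card ι : ℤ)]
    ring
  -- The determinant of a polynomial matrix has no negative exponents.
  have hnn : 0 ≤ (N₀ * Fintype.card ι + D : ℤ) := by
    by_contra hneg
    have h1 := mem_chartRing_zero_iff_coeff.1 (toLaurent_mem_chartRing M'.det) _ (not_le.1 hneg)
    rw [hdet', ← LaurentPolynomial.smul_eq_C_mul, AddMonoidAlgebra.coeff_smul, Finsupp.smul_apply,
      T_apply, if_pos rfl, smul_eq_mul, mul_one] at h1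
    exact hc h1
  obtain ⟨s, hs⟩ := Int.eq_ofNat_of_zero_le hnn
  have hdet'' : M'.det = Polynomial.C c * X ^ s := by
    apply toLaurent_injective
    rw [hdet', hs, map_mul, toLaurent_C, toLaurent_X_pow]
  have h1 : ∀ j, (T (N₀ : ℤ) : K[T;T⁻¹]) • x j = ∑ i, toLaurent (M' i j) • B i := by
    intro j
    simp only [hM j, Finset.smul_sum, smul_smul, hM']
  obtain ⟨a, v, hv, ha⟩ := exists_isFrame_of_det_eq B hB s M' _ (fun _ => -(N₀ : ℤ)) c h1
    (by simpa only [smul_smul, T_neg_mul_T, one_smul] using hx) hc hdet''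
  refine ⟨a, v, hv, ha.trans ?_⟩
  rw [Finset.sum_const, Finset.card_univ, nsmul_eq_mul]
  have : (s : ℤ) = N₀ * Fintype.card ι + D := hs.symm
  rw [this]
  ring

end Existence

/-! ### Bases over the charts and additivity of the degree. -/

section Degree

variable {K : Type u} [Field K] {V : Type v} [AddCommGroup V] [Module K[T;T⁻¹] V]
  {S : ∀ i : Fin 2, Submodule (chartRing K i) V}

/-- A relation over the overlap becomes one over the chart after multiplication by a power of the
coordinate, which is a unit on the overlap. -/
theorem linearIndependent_of_chartRing {ι : Type*} [Fintype ι] {i : Fin 2} {x : ι → V}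
    (h : ∀ c : ι → chartRing K i, ∑ j, (c j : K[T;T⁻¹]) • x j = 0 → ∀ j, c j = 0) :
    LinearIndependent K[T;T⁻¹] x := by
  rw [Fintype.linearIndependent_iff]
  intro f hf j
  choose m hm using fun j => VectorBundle.exists_T_mul_mem i (f j)
  let d : ℤ := (![1, -1] : Fin 2 → ℤ) i * (Finset.univ.sup m : ℕ)
  have h1 : ∀ j, T d * f j ∈ chartRing K i := fun j => hm j _ (Finset.le_sup (Finset.mem_univ j))
  have h2 := h (fun j => ⟨_, h1 j⟩) (by
    change ∑ j, (T d * f j) • x j = 0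
    simp only [mul_smul, ← Finset.smul_sum, hf, smul_zero]) j
  have h3 : T d * f j = 0 := congrArg Subtype.val h2
  have h4 : f j = T (-d) * (T d * f j) := by rw [← mul_assoc, T_neg_mul_T, one_mul]
  rw [h4, h3, mul_zero]

/-- A basis of the sections over a chart is a basis of the sections over the overlap. -/
theorem exists_overlap_basis {i : Fin 2} {ι : Type*} [Fintype ι] {N : Submodule (chartRing K i) V}
    (hN : Submodule.span K[T;T⁻¹] (N : Set V) = ⊤) (b : Module.Basis ι (chartRing K i) N) :
    ∃ B : Module.Basis ι K[T;T⁻¹] V, (∀ j, B j = b j) ∧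
      N = Submodule.span (chartRing K i) (Set.range B) := by
  have hli : LinearIndependent K[T;T⁻¹] (fun j => (b j : V)) := by
    refine linearIndependent_of_chartRing (i := i) fun c hc => ?_
    have h0 : ∑ j, c j • b j = 0 := by
      apply Subtype.ext
      rw [Submodule.coe_sum]
      exact hc
    intro j
    have h1 := congrFun (b.repr_sum_self c) j
    rw [h0, map_zero] at h1
    exact h1.symm
  have hspan : N = Submodule.span (chartRing K i) (Set.range fun j => (b j : V)) := by
    have h := congrArg (Submodule.map N.subtype) b.span_eq
    rw [Submodule.map_span, Submodule.map_top, Submodule.range_subtype, ← Set.range_comp] at h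
    exact h.symm
  have htop : Submodule.span K[T;T⁻¹] (Set.range fun j => (b j : V)) = ⊤ := by
    rw [← Submodule.span_span_of_tower (chartRing K i), ← hspan, hN]
  let B := Module.Basis.mk hli htop.ge
  have hB : ∀ j, B j = b j := fun j => Module.Basis.mk_apply _ _ j
  exact ⟨B, hB, by rw [funext hB]; exact hspan⟩

theorem prod_T {ι : Type*} (s : Finset ι) (a : ι → ℤ) :
    ∏ j ∈ s, (T (a j) : K[T;T⁻¹]) = T (∑ j ∈ s, a j) := by
  classical
  induction s using Finset.induction_on with
  | empty => simp
  | insert j s hj ih => rw [Finset.prod_insert hj, Finset.sum_insert hj, ih, T_add]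

/-- The degree is additive in short exact sequences. -/
theorem IsFrame.exists_isFrame_of_exact {V₁ V₂ : Type*} [AddCommGroup V₁] [Module K[T;T⁻¹] V₁]
    [AddCommGroup V₂] [Module K[T;T⁻¹] V₂] {S₁ : ∀ i : Fin 2, Submodule (chartRing K i) V₁}
    {S₂ : ∀ i : Fin 2, Submodule (chartRing K i) V₂} {ι κ : Type*} [Fintype ι] [Fintype κ]
    {a : ι → ℤ} {b : κ → ℤ} {v : Module.Basis ι K[T;T⁻¹] V₁} {w : Module.Basis κ K[T;T⁻¹] V₂}
    (hv : IsFrame S₁ a v) (hw : IsFrame S₂ b w) (f : V₁ →ₗ[K[T;T⁻¹]] V) (g : V →ₗ[K[T;T⁻¹]] V₂)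
    (hf : Function.Injective f) (hfg : Function.Exact f g) (h₁ : ∀ i x, x ∈ S₁ i ↔ f x ∈ S i)
    (h₂ : ∀ i y, y ∈ S₂ i ↔ ∃ x ∈ S i, g x = y) :
    ∃ (c : ι ⊕ κ → ℤ) (u : Module.Basis (ι ⊕ κ) K[T;T⁻¹] V),
      IsFrame S c u ∧ ∑ j, c j = ∑ j, a j + ∑ j, b j := by
  classical
  -- The quotient frame lifts over each chart separately; the two lifts need not match on the
  -- overlap.
  have hlift : ∀ i j, ∃ x ∈ S i, g x = (T (twist (b j) i) : K[T;T⁻¹]) • w j :=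
    fun i j => (h₂ i _).1 (hw.smul_mem i j)
  choose y hyS hy using hlift
  have hy0 : ∀ j, g (y 0 j) = w j := fun j => by rw [hy, twist_at_zero, T_zero, one_smul]
  have hgf : ∀ x, g (f x) = 0 := fun x => (hfg _).2 ⟨x, rfl⟩
  have hdecomp : ∀ x, ∃ z : V₁, x = f z + ∑ j, w.repr (g x) j • y 0 j := by
    intro x
    obtain ⟨z, hz⟩ := (hfg (x - ∑ j, w.repr (g x) j • y 0 j)).1 (by
      simp only [map_sub, map_sum, map_smul, hy0, w.sum_repr, sub_self])
    exact ⟨z, by rw [hz, sub_add_cancel]⟩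
  have hli : LinearIndependent K[T;T⁻¹] (Sum.elim (fun j => f (v j)) (y 0)) := by
    rw [Fintype.linearIndependent_iff]
    intro c hc
    rw [Fintype.sum_sum_type] at hc
    simp only [Sum.elim_inl, Sum.elim_inr] at hc
    have h2 := congrArg g hc
    simp only [map_add, map_sum, map_smul, hgf, hy0, smul_zero, Finset.sum_const_zero, zero_add,
      map_zero] at h2
    have h3 := Fintype.linearIndependent_iff.1 w.linearIndependent _ h2
    simp only [h3, zero_smul, Finset.sum_const_zero, add_zero, ← map_smul, ← map_sum] at hc
    have h4 := Fintype.linearIndependent_iff.1 v.linearIndependent _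
      (hf (hc.trans (map_zero f).symm))
    rintro (j | j)
    · exact h4 j
    · exact h3 j
  let B := Module.Basis.mk hli (by
    rintro x -
    obtain ⟨z, hz⟩ := hdecomp x
    rw [hz, ← v.sum_repr z, map_sum]
    refine add_mem (sum_mem fun j _ => ?_) (sum_mem fun j _ => ?_)
    · rw [map_smul]
      exact Submodule.smul_mem _ _ (Submodule.subset_span ⟨Sum.inl j, rfl⟩)
    · exact Submodule.smul_mem _ _ (Submodule.subset_span ⟨Sum.inr j, rfl⟩))
  have hB : ∀ j, B j = Sum.elim (fun j => f (v j)) (y 0) j := fun j => Module.Basis.mk_apply _ _ j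
  have hspan : ∀ i, S i = Submodule.span (chartRing K i)
      (Set.range (Sum.elim (fun j => (T (twist (a j) i) : K[T;T⁻¹]) • f (v j)) (y i))) := by
    intro i
    apply le_antisymm
    · intro x hx
      have hgx := (hw i (g x)).1 ((h₂ i _).2 ⟨x, hx, rfl⟩)
      have hmem : ∑ j, (T (-twist (b j) i) * w.repr (g x) j) • y i j ∈ S i :=
        chart_sum_smul_mem _ (fun j _ => hgx j) fun j _ => hyS i j
      obtain ⟨z, hz⟩ := (hfg (x - ∑ j, (T (-twist (b j) i) * w.repr (g x) j) • y i j)).1 (by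
        simp only [map_sub, map_sum, map_smul, hy, smul_smul, mul_right_comm _ _ (T _),
          T_neg_mul_T, one_mul, w.sum_repr, sub_self])
      have hzS := (hv i z).1 ((h₁ i z).2 (hz ▸ sub_mem hx hmem))
      rw [sub_eq_iff_eq_add.1 hz.symm, ← v.sum_repr z, map_sum]
      refine add_mem ?_ ?_
      · have : ∀ j, f (v.repr z j • v j) = (T (-twist (a j) i) * v.repr z j) •
            (T (twist (a j) i) : K[T;T⁻¹]) • f (v j) := fun j => by
          rw [smul_smul, mul_right_comm, T_neg_mul_T, one_mul, map_smul]
        rw [Finset.sum_congr rfl fun j _ => this j]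
        exact chart_sum_smul_mem _ (fun j _ => hzS j)
          fun j _ => Submodule.subset_span ⟨Sum.inl j, rfl⟩
      · exact chart_sum_smul_mem _ (fun j _ => hgx j)
          fun j _ => Submodule.subset_span ⟨Sum.inr j, rfl⟩
    · rw [Submodule.span_le]
      rintro _ ⟨j | j, rfl⟩
      · have := (h₁ i _).1 (hv.smul_mem i j)
        rwa [map_smul] at this
      · exact hyS i j
  -- The discrepancy of the two lifts lies in the subbundle. So the transition matrix is block
  -- triangular with diagonal blocks `T (a j)` and `T (b j)`, and only its determinant matters.
  have hy1 : ∀ j, ∃ z : V₁, y 1 j = f z + (T (b j) : K[T;T⁻¹]) • y 0 j := by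
    intro j
    obtain ⟨z, hz⟩ := hdecomp (y 1 j)
    refine ⟨z, hz.trans ?_⟩
    rw [hy, twist_at_one, Finset.sum_eq_single j]
    · simp
    · intro k _ hk
      simp [hk.symm]
    · simp
  choose z hz using hy1
  have hB0 : S 0 = Submodule.span (chartRing K 0) (Set.range B) := by
    rw [hspan 0, funext hB]
    simp only [twist_at_zero, T_zero, one_smul]
  obtain ⟨c, u, hu, hc⟩ := exists_isFrame_of_transition (D := ∑ j, a j + ∑ j, b j) (c := 1)
    B hB0 _ (hspan 1)
    (Matrix.fromBlocks (Matrix.diagonal fun j => T (a j)) (Matrix.of fun i j => v.repr (z j) i) 0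
      (Matrix.diagonal fun j => T (b j))) (by
        rintro (j | j)
        · simp [Fintype.sum_sum_type, hB, Matrix.diagonal_apply]
        · simp only [Fintype.sum_sum_type, hB, Sum.elim_inr, Sum.elim_inl,
            Matrix.fromBlocks_apply₁₂, Matrix.fromBlocks_apply₂₂, Matrix.of_apply, hz,
            Matrix.diagonal_apply, ite_smul, zero_smul, Finset.sum_ite_eq', Finset.mem_univ,
            if_true, ← map_smul, ← map_sum, v.sum_repr]) one_ne_zero (by
        rw [Matrix.det_fromBlocks_zero₂₁, Matrix.det_diagonal, Matrix.det_diagonal, prod_T, prod_T,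
          T_add, map_one, one_mul])
  exact ⟨c, u, hu, hc⟩

end Degree

/-! ### Existence and uniqueness of splitting types of vector bundles. -/

namespace VectorBundle

variable {K : Type u} [Field K] {E : VectorBundle K}

theorem HasFrame.exists_equiv {ι κ : Type*} [Fintype ι] [Fintype κ] {a : ι → ℤ} {b : κ → ℤ}
    (ha : E.HasFrame a) (hb : E.HasFrame b) : ∃ e : ι ≃ κ, ∀ j, b (e j) = a j := by
  obtain ⟨v, hv⟩ := ha
  obtain ⟨w, hw⟩ := hb
  exact hv.exists_equiv hw

theorem HasFrame.finrank_eq {ι : Type*} [Fintype ι] {a : ι → ℤ} (ha : E.HasFrame a) :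
    Module.finrank K[T;T⁻¹] E.Overlap = Fintype.card ι := by
  obtain ⟨v, -⟩ := ha
  exact Module.finrank_eq_card_basis v

/-- The transition matrix in the definition of the degree yields some frame with sum `d`; uniqueness
carries the sum over to the given one. -/
theorem HasFrame.sum_eq_of_hasDegree {ι : Type*} [Fintype ι] {a : ι → ℤ} (ha : E.HasFrame a)
    {d : ℤ} (hd : E.HasDegree d) : ∑ j, a j = d := by
  obtain ⟨m, v, w, M, c, hc, hM, hdet⟩ := hd
  obtain ⟨B, hB, hspan⟩ := exists_overlap_basis (E.span_sections 0) v
  obtain ⟨B', hB', hspan'⟩ := exists_overlap_basis (E.span_sections 1) w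
  obtain ⟨a', v', hv', hsum⟩ := exists_isFrame_of_transition (S := E.sections) B hspan B' hspan' M
    (fun j => by simp only [hB', hM, hB]) hc hdet
  obtain ⟨e, he⟩ := ha.exists_equiv ⟨v', hv'⟩
  rw [← hsum, ← e.sum_comp]
  simp only [he]

variable (E) in
-- The chart ring is a principal ideal domain, over which a finitely generated torsion-free module
-- is free.
theorem exists_chart_basis (i : Fin 2) : ∃ (m : ℕ) (B : Module.Basis (Fin m) K[T;T⁻¹] E.Overlap),
    E.sections i = Submodule.span (chartRing K i) (Set.range B) := by
  have hpir : IsPrincipalIdealRing (chartRing K i) :=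
    IsPrincipalIdealRing.of_surjective (chartHom K i).rangeRestrict
      (chartHom K i).rangeRestrict_surjective
  have := E.projective
  have htf : Module.IsTorsionFree K[T;T⁻¹] E.Overlap := inferInstance
  have htf' : Module.IsTorsionFree (chartRing K i) (E.sections i) := by
    refine Module.IsTorsionFree.of_smul_eq_zero (R := chartRing K i) (M := E.sections i) fun c x hcx => ?_
    have h1 : (c : K[T;T⁻¹]) • (x : E.Overlap) = 0 := congrArg Subtype.val hcx
    rcases smul_eq_zero.1 h1 with h2 | h2
    · exact Or.inl (Subtype.ext h2)
    · exact Or.inr (Subtype.ext h2)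
  have hfin : Module.Finite (chartRing K i) (E.sections i) :=
    Module.Finite.iff_fg.2 (E.sections_fg i)
  have := Module.free_of_finite_type_torsion_free' (R := chartRing K i) (M := E.sections i)
  obtain ⟨B, -, hB⟩ := exists_overlap_basis (E.span_sections i)
    (Module.finBasis (chartRing K i) (E.sections i))
  exact ⟨_, B, hB⟩

variable (E) in
theorem exists_hasFrame : ∃ (m : ℕ) (a : Fin m → ℤ), E.HasFrame a := by
  obtain ⟨m, B, hB⟩ := E.exists_chart_basis 0
  obtain ⟨m', B', hB'⟩ := E.exists_chart_basis 1
  obtain rfl : m = m' := by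
    simpa using Fintype.card_congr (B.indexEquiv B')
  have hu : IsUnit (B.toMatrix B').det := by
    refine IsUnit.of_mul_eq_one (B'.toMatrix B).det ?_
    rw [← Matrix.det_mul, Module.Basis.toMatrix_mul_toMatrix_flip, Matrix.det_one]
  obtain ⟨c, d, hc, hdet⟩ := exists_C_mul_T_of_isUnit hu
  obtain ⟨a, v, hv, -⟩ := exists_isFrame_of_transition (S := E.sections) B hB B' hB'
    (B.toMatrix B') (fun j => (B.sum_toMatrix_smul_self B' j).symm) hc hdet
  exact ⟨m, a, v, hv⟩

/-- Biduality is not needed: `E` has some frame, its dual frame has the negated type, and uniqueness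
compares that type with `a`. -/
theorem HasFrame.of_dual {ι : Type*} [Fintype ι] {a : ι → ℤ} (h : E.dual.HasFrame a) :
    E.HasFrame (fun j => -a j) := by
  obtain ⟨m, b, hb⟩ := E.exists_hasFrame
  obtain ⟨e, he⟩ := hb.dual.exists_equiv h
  convert hb.reindex e using 1
  funext j
  have := he (e.symm j)
  rw [e.apply_symm_apply] at this
  rw [this, neg_neg, Function.comp_apply]

/-- Every vector bundle of rank `m` on the projective line has an increasing splitting type. -/
theorem exists_monotone_hasFrame {m : ℕ} (h : Module.finrank K[T;T⁻¹] E.Overlap = m) :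
    ∃ a : Fin m → ℤ, Monotone a ∧ E.HasFrame a := by
  obtain ⟨m', a, ha⟩ := E.exists_hasFrame
  obtain rfl : m' = m := by simpa using ha.finrank_eq.symm.trans h
  exact ⟨_, Tuple.monotone_sort a, by simpa using ha.reindex (Tuple.sort a).symm⟩

theorem HasFrame.eq_of_monotone {m : ℕ} {a b : Fin m → ℤ} (ha : E.HasFrame a) (hb : E.HasFrame b)
    (ha' : Monotone a) (hb' : Monotone b) : a = b := by
  obtain ⟨e, he⟩ := ha.exists_equiv hb
  have h1 : b ∘ e = a := funext he
  have := Tuple.unique_monotone (f := b) (σ := e) (τ := Equiv.refl _) (h1 ▸ ha') hb'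
  exact h1.symm.trans this

end VectorBundle

/-! ### Equations for a direct summand that are compatible with base change. -/

section Projector

variable {A : Type u} [CommRing A] {n : ℕ}

/-- A matrix whose kernel is the direct summand `N` and which is the identity modulo `N`. -/
def IsProjector (N : Submodule A (Fin n → A)) (D : Matrix (Fin n) (Fin n) A) : Prop :=
  ∀ v, (v ∈ N → D.mulVec v = 0) ∧ v - D.mulVec v ∈ N

/-- A splitting of the projective quotient, composed with the projection, is an endomorphism of `A ^
n` with kernel `N`. Its rows are finitely many equations for `N`. -/
theorem exists_isProjector (N : Submodule A (Fin n → A))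
    [Module.Projective A ((Fin n → A) ⧸ N)] : ∃ D, IsProjector N D := by
  obtain ⟨t, ht⟩ := Module.projective_lifting_property N.mkQ LinearMap.id
    (Submodule.mkQ_surjective _)
  refine ⟨LinearMap.toMatrix' (t ∘ₗ N.mkQ), fun v => ?_⟩
  rw [← Matrix.toLin'_apply, Matrix.toLin'_toMatrix', LinearMap.comp_apply]
  constructor
  · intro hv
    rw [Submodule.mkQ_apply, (Submodule.Quotient.mk_eq_zero N).2 hv, map_zero]
  · rw [← Submodule.Quotient.mk_eq_zero, ← Submodule.mkQ_apply, map_sub, sub_eq_zero]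
    exact (LinearMap.congr_fun ht (N.mkQ v)).symm

theorem map_mulVec {A' : Type v} [CommRing A'] (f : A →+* A') (D : Matrix (Fin n) (Fin n) A)
    (v : Fin n → A) : (D.map f).mulVec (fun j => f (v j)) = fun j => f (D.mulVec v j) := by
  funext i
  simp only [Matrix.mulVec, dotProduct, Matrix.map_apply, map_sum, map_mul]

theorem IsProjector.map {N : Submodule A (Fin n → A)} {D : Matrix (Fin n) (Fin n) A}
    (hD : IsProjector N D) {A' : Type v} [CommRing A'] (f : A →+* A') :
    IsProjector (extend f N) (D.map f) := by
  intro v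
  constructor
  · intro hv
    change v ∈ LinearMap.ker (Matrix.mulVecLin (D.map f))
    refine (Submodule.span_le.2 ?_ : extend f N ≤ _) hv
    rintro _ ⟨x, hx, rfl⟩
    change (D.map f).mulVec (fun j => f (x j)) = 0
    rw [map_mulVec, (hD x).1 hx]
    funext j
    simp
  -- By linearity it suffices to treat the standard basis vectors, which are defined over `A`.
  · have h : v - (D.map f).mulVec v = ∑ k, v k • fun j => f ((Pi.single k 1 : Fin n → A) j -
        D.mulVec (Pi.single k 1) j) := by
      funext j
      simp only [Matrix.mulVec_single_one, Pi.sub_apply, Finset.sum_apply, Pi.smul_apply,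
        smul_eq_mul, map_sub, mul_sub, Finset.sum_sub_distrib, Matrix.col_apply]
      congr 1
      · rw [Finset.sum_eq_single j]
        · simp
        · intro k _ hk
          rw [Pi.single_eq_of_ne hk.symm, map_zero, mul_zero]
        · simp
      · simp only [Matrix.mulVec, dotProduct, Matrix.map_apply, mul_comm]
    rw [h]
    exact Submodule.sum_mem _ fun k _ => Submodule.smul_mem _ _
      (Submodule.subset_span ⟨_, (hD (Pi.single k 1)).2, rfl⟩)

theorem IsProjector.mem_iff {N : Submodule A (Fin n → A)} {D : Matrix (Fin n) (Fin n) A}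
    (hD : IsProjector N D) {v : Fin n → A} : v ∈ N ↔ ∀ i, ∑ j, D i j * v j = 0 := by
  refine ⟨fun h => congrFun ((hD v).1 h), fun h => ?_⟩
  have h1 := (hD v).2
  rwa [show D.mulVec v = 0 from funext h, sub_zero] at h1

/-- The same equations define both submodules, and an injective map detects whether they hold. -/
theorem IsProjector.mem_extend_iff {N : Submodule A (Fin n → A)} {D : Matrix (Fin n) (Fin n) A}
    (hD : IsProjector N D) {A' : Type v} [CommRing A'] {f : A →+* A'} (hf : Function.Injective f)
    {v : Fin n → A} : (fun j => f (v j)) ∈ extend f N ↔ v ∈ N := by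
  rw [hD.mem_iff, (hD.map f).mem_iff]
  refine forall_congr' fun i => ?_
  simp only [Matrix.map_apply, ← map_mul, ← map_sum, map_eq_zero_iff f hf]

end Projector

/-! ### The universal subbundle and quotient bundle along a morphism. -/

section BundlesOfMorphism

variable {K : Type u} [Field K] {r n : ℕ}

/-- The sections of the trivial bundle `𝒪 ^ n` over a chart. -/
def trivialSections (K : Type u) [Field K] (n : ℕ) (i : Fin 2) :
    Submodule (chartRing K i) (Fin n → K[T;T⁻¹]) where
  carrier := {x | ∀ j, x j ∈ chartRing K i}
  add_mem' hx hy j := add_mem (hx j) (hy j)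
  zero_mem' _ := zero_mem _
  smul_mem' c _ hx j := mul_mem c.2 (hx j)

theorem single_mem_trivialSections (i : Fin 2) (j : Fin n) :
    Pi.single j 1 ∈ trivialSections K n i := by
  intro k
  rw [Pi.single_apply]
  split_ifs
  · exact one_mem _
  · exact zero_mem _

theorem isFrame_trivialSections : IsFrame (trivialSections K n) (fun _ => 0)
    (Pi.basisFun K[T;T⁻¹] (Fin n)) := by
  intro i x
  have : twist 0 i = 0 := by fin_cases i <;> rfl
  simp only [this, neg_zero, T_zero, one_mul, Pi.basisFun_repr]
  rfl

theorem chartHom_injective (i : Fin 2) : Function.Injective (chartHom K i).toRingHom := by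
  fin_cases i
  · exact toLaurent_injective
  · exact (invert (R := K)).injective.comp toLaurent_injective

namespace Morphism

variable (φ : Morphism K r n)

/-- The subbundle is saturated in `𝒪 ^ n`, being a direct summand over each chart; this is what
allows its sections to be counted by equations. -/
theorem mem_sub_sections (i : Fin 2) (x : φ.onOverlap.toSubmodule) :
    x ∈ φ.sub.sections i ↔ (x : Fin n → K[T;T⁻¹]) ∈ trivialSections K n i := by
  change (x : Fin n → K[T;T⁻¹]) ∈ φ.chartSections i ↔ _
  constructor
  · intro hx
    refine (Submodule.span_le.2 ?_ : φ.chartSections i ≤ _) hx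
    rintro _ ⟨v, -, rfl⟩ j
    exact ⟨v j, rfl⟩
  · intro hx
    choose v hv using hx
    have hv' : (fun j => (chartHom K i).toRingHom (v j)) = (x : Fin n → K[T;T⁻¹]) := funext hv
    have := (φ.onChart i).projective_quotient
    obtain ⟨D, hD⟩ := exists_isProjector (φ.onChart i).toSubmodule
    have h1 : (fun j => (chartHom K i).toRingHom (v j)) ∈
        extend (chartHom K i).toRingHom (φ.onChart i).toSubmodule := by
      rw [hv']
      have := congrArg (fun N => (x : Fin n → K[T;T⁻¹]) ∈ N.toSubmodule) (φ.pointMap_onChart i)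
      exact this.mpr x.2
    refine Submodule.subset_span ⟨v, ?_, hv'⟩
    exact (hD.mem_extend_iff (chartHom_injective i)).1 h1

theorem mem_quot_sections (i : Fin 2) (y : (Fin n → K[T;T⁻¹]) ⧸ φ.onOverlap.toSubmodule) :
    y ∈ φ.quot.sections i ↔ ∃ x ∈ trivialSections K n i, φ.onOverlap.toSubmodule.mkQ x = y := by
  change y ∈ Submodule.span (chartRing K i)
    (Set.range fun j : Fin n => φ.onOverlap.toSubmodule.mkQ (Pi.single j 1)) ↔ _
  constructor
  · intro hy
    refine (Submodule.span_le.2 ?_ : _ ≤ (trivialSections K n i).map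
      (φ.onOverlap.toSubmodule.mkQ.restrictScalars (chartRing K i))) hy
    rintro _ ⟨j, rfl⟩
    exact ⟨Pi.single j 1, single_mem_trivialSections i j, rfl⟩
  · rintro ⟨x, hx, rfl⟩
    have : φ.onOverlap.toSubmodule.mkQ x =
        ∑ j, x j • φ.onOverlap.toSubmodule.mkQ (Pi.single j 1) := by
      conv_lhs => rw [← (Pi.basisFun K[T;T⁻¹] (Fin n)).sum_repr x]
      simp only [map_sum, map_smul, Pi.basisFun_repr, Pi.basisFun_apply]
    rw [this]
    exact chart_sum_smul_mem _ (fun j _ => hx j) fun j _ => Submodule.subset_span ⟨j, rfl⟩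

/-- The degree is additive in `0 → 𝒮 → 𝒪 ^ n → 𝒬 → 0`, and the trivial bundle has degree zero. -/
theorem sum_add_sum_eq_zero {ι κ : Type*} [Fintype ι] [Fintype κ] {a : ι → ℤ} {b : κ → ℤ}
    (ha : φ.sub.HasFrame a) (hb : φ.quot.HasFrame b) : ∑ j, a j + ∑ j, b j = 0 := by
  obtain ⟨v, hv⟩ := ha
  obtain ⟨w, hw⟩ := hb
  obtain ⟨c, u, hu, hc⟩ := hv.exists_isFrame_of_exact (S := trivialSections K n) hw
    φ.onOverlap.toSubmodule.subtype φ.onOverlap.toSubmodule.mkQ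
    (Submodule.injective_subtype _) (LinearMap.exact_subtype_mkQ _)
    φ.mem_sub_sections φ.mem_quot_sections
  obtain ⟨e, he⟩ := hu.exists_equiv isFrame_trivialSections
  rw [← hc]
  exact Finset.sum_eq_zero fun j _ => (he j).symm

theorem finrank_quot : Module.finrank K[T;T⁻¹] φ.quot.Overlap = n - r := by
  obtain ⟨m, a, v, -⟩ := φ.quot.exists_hasFrame
  have hfree : Module.Free K[T;T⁻¹] ((Fin n → K[T;T⁻¹]) ⧸ φ.onOverlap.toSubmodule) :=
    Module.Free.of_basis v
  -- The rank is constant, so any prime will do; the zero ideal is at hand.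
  have h := congrFun (Module.rankAtStalk_eq_finrank_of_free (R := K[T;T⁻¹])
    (M := (Fin n → K[T;T⁻¹]) ⧸ φ.onOverlap.toSubmodule)) ⟨⊥, Ideal.isPrime_bot⟩
  rw [φ.onOverlap.rankAtStalk_eq] at h
  exact h.symm

theorem finrank_sub (hr : r ≤ n) : Module.finrank K[T;T⁻¹] φ.sub.Overlap = r := by
  have h := φ.onOverlap.toSubmodule.finrank_quotient_add_finrank
  rw [Module.finrank_fin_fun] at h
  have h1 : Module.finrank K[T;T⁻¹] φ.onOverlap.toSubmodule = r := by
    have h2 := φ.finrank_quot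
    change Module.finrank K[T;T⁻¹] ((Fin n → K[T;T⁻¹]) ⧸ φ.onOverlap.toSubmodule) = n - r at h2
    omega
  exact h1

/-- The sections of degree less than `m` of the universal subbundle. -/
def subSolutions (m : ℕ) : Submodule K (Fin n → K[X]) where
  carrier := {x | (∀ j, x j ∈ Polynomial.degreeLT K m) ∧ x ∈ (φ.onChart 0).toSubmodule}
  add_mem' hx hy := ⟨fun j => add_mem (hx.1 j) (hy.1 j), add_mem hx.2 hy.2⟩
  zero_mem' := ⟨fun _ => zero_mem _, zero_mem _⟩
  smul_mem' c x hx := ⟨fun j => Submodule.smul_mem _ c (hx.1 j), by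
    have : c • x = Polynomial.C c • x := by
      funext j
      simp [Polynomial.smul_eq_C_mul]
    rw [this]
    exact Submodule.smul_mem _ _ hx.2⟩

theorem subSolutions_eq {D : Matrix (Fin n) (Fin n) K[X]}
    (hD : IsProjector (φ.onChart 0).toSubmodule D) (m : ℕ) :
    φ.subSolutions m = solutions (Set.range fun i j => D i j) m := by
  ext x
  change (_ ∧ _) ↔ (_ ∧ _)
  rw [hD.mem_iff, Set.forall_mem_range]

/-- The left side is the number of sections of `φ^* 𝒮(m - 1)`, where `φ^* 𝒮` is the sum of the `𝒪(-a
j)`. -/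
theorem finrank_subSolutions {ι : Type*} [Fintype ι] {a : ι → ℤ} (ha : φ.sub.dual.HasFrame a)
    (m : ℕ) : Module.finrank K (φ.subSolutions m) = ∑ j, (m - a j).toNat := by
  obtain ⟨v, hv⟩ := ha.of_dual
  have := (φ.onChart 0).projective_quotient
  obtain ⟨D, hD⟩ := exists_isProjector (φ.onChart 0).toSubmodule
  rw [φ.subSolutions_eq hD]
  have hrange : ∀ y, y ∈ LinearMap.range φ.onOverlap.toSubmodule.subtype ↔
      ∀ γ ∈ Set.range fun i j => D i j, ∑ j, toLaurent (γ j) * y j = 0 := by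
    intro y
    rw [Submodule.range_subtype, Set.forall_mem_range]
    exact (hD.map (chartHom K 0).toRingHom).mem_iff
  exact hv.finrank_solutions φ.onOverlap.toSubmodule.subtype (Submodule.injective_subtype _)
    φ.mem_sub_sections hrange m

/-- The dual of `𝒬` is the annihilator of `𝒮` in `𝒪 ^ n`, so orthogonality to `𝒮` describes the
sections of `φ^* 𝒬^*(m - 1)`. -/
theorem finrank_quotSolutions {ι : Type*} [Fintype ι] {b : ι → ℤ} (hb : φ.quot.HasFrame b)
    (m : ℕ) : Module.finrank K (solutions ((φ.onChart 0).toSubmodule : Set (Fin n → K[X])) m) =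
      ∑ j, (m - b j).toNat := by
  obtain ⟨v, hv⟩ := hb.dual
  let f : Module.Dual K[T;T⁻¹] ((Fin n → K[T;T⁻¹]) ⧸ φ.onOverlap.toSubmodule) →ₗ[K[T;T⁻¹]]
      (Fin n → K[T;T⁻¹]) :=
    LinearMap.pi fun j => LinearMap.applyₗ (φ.onOverlap.toSubmodule.mkQ (Pi.single j 1))
  have hfx : ∀ g x, g (φ.onOverlap.toSubmodule.mkQ x) = ∑ j, x j * f g j := by
    intro g x
    conv_lhs => rw [← (Pi.basisFun K[T;T⁻¹] (Fin n)).sum_repr x]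
    simp only [map_sum, map_smul, Pi.basisFun_repr, Pi.basisFun_apply]
    rfl
  have hinj : Function.Injective f := by
    intro g g' h
    refine LinearMap.ext fun y => ?_
    obtain ⟨x, rfl⟩ := Submodule.mkQ_surjective _ y
    rw [hfx, hfx, h]
  have hsec : ∀ i g, g ∈ φ.quot.dualSections i ↔ ∀ j, f g j ∈ chartRing K i := by
    intro i g
    constructor
    · intro h j
      exact h _ ((φ.mem_quot_sections i _).2 ⟨_, single_mem_trivialSections i j, rfl⟩)
    · intro h y hy
      obtain ⟨x, hx, rfl⟩ := (φ.mem_quot_sections i y).1 hy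
      exact (hfx g x).symm ▸ sum_mem fun j _ => mul_mem (hx j) (h j)
  have hrange : ∀ y, y ∈ LinearMap.range f ↔
      ∀ γ ∈ ((φ.onChart 0).toSubmodule : Set (Fin n → K[X])),
        ∑ j, toLaurent (γ j) * y j = 0 := by
    intro y
    constructor
    · rintro ⟨g, rfl⟩ γ hγ
      have h1 := hfx g fun j => toLaurent (γ j)
      have h2 : (fun j => toLaurent (γ j)) ∈ φ.onOverlap.toSubmodule :=
        Submodule.subset_span ⟨γ, hγ, rfl⟩
      rw [Submodule.mkQ_apply, (Submodule.Quotient.mk_eq_zero _).2 h2, map_zero] at h1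
      exact h1.symm
    · intro h
      -- A vector orthogonal to `𝒮` is a linear form on `𝒪 ^ n` that vanishes on `𝒮`, hence descends
      -- to `𝒬`.
      let g₀ : (Fin n → K[T;T⁻¹]) →ₗ[K[T;T⁻¹]] K[T;T⁻¹] :=
        Fintype.linearCombination K[T;T⁻¹] y
      have hg₀ : φ.onOverlap.toSubmodule ≤ LinearMap.ker g₀ := by
        refine Submodule.span_le.2 ?_
        rintro _ ⟨γ, hγ, rfl⟩
        exact h γ hγ
      refine ⟨φ.onOverlap.toSubmodule.liftQ g₀ hg₀, funext fun j => ?_⟩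
      change φ.onOverlap.toSubmodule.liftQ g₀ hg₀ (φ.onOverlap.toSubmodule.mkQ (Pi.single j 1)) = _
      rw [Submodule.mkQ_apply, Submodule.liftQ_apply]
      simp [g₀, Fintype.linearCombination_apply, Pi.single_apply]
  exact hv.finrank_solutions f hinj hsec hrange m

end Morphism

end BundlesOfMorphism

/-! ### Semicontinuity of solution spaces in families. -/

section Semicontinuity

open scoped Topology

variable {K : Type u} [Field K]

/-- The solutions of a system of homogeneous linear equations. -/
def linearSolutions {ι : Type*} [Fintype ι] (Λ : Set (ι → K)) : Submodule K (ι → K) where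
  carrier := {c | ∀ l ∈ Λ, ∑ i, l i * c i = 0}
  add_mem' hc hd l hl := by
    simp only [Pi.add_apply, mul_add, Finset.sum_add_distrib, hc l hl, hd l hl, add_zero]
  zero_mem' l _ := by simp
  smul_mem' a c hc l hl := by
    simp only [Pi.smul_apply, mul_smul_comm, ← Finset.smul_sum, hc l hl, smul_zero]

theorem finrank_linearSolutions_le {ι κ : Type*} [Fintype ι] [Fintype κ] {Λ : Set (ι → K)}
    (M : Matrix κ ι K) (hM : ∀ i, M i ∈ Λ) :
    Module.finrank K (linearSolutions Λ) + M.rank ≤ Fintype.card ι := by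
  have h1 := LinearMap.finrank_range_add_finrank_ker M.mulVecLin
  rw [Module.finrank_fintype_fun_eq_card] at h1
  have h2 : linearSolutions Λ ≤ LinearMap.ker M.mulVecLin := fun c hc =>
    LinearMap.mem_ker.2 (funext fun i => hc _ (hM i))
  have h3 := Submodule.finrank_mono h2
  rw [Matrix.rank]
  omega

/-- A maximal independent set of equations from `Λ` has the same solutions. Its right inverse `G`
certifies the rank in a form that can be carried to nearby parameters. -/
theorem exists_matrix_of_linearSolutions {ι : Type*} [Fintype ι] (Λ : Set (ι → K)) :
    ∃ (s : ℕ) (M : Matrix (Fin s) ι K) (G : Matrix ι (Fin s) K), (∀ i, M i ∈ Λ) ∧ M * G = 1 ∧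
      Module.finrank K (linearSolutions Λ) + s = Fintype.card ι := by
  obtain ⟨b, hbΛ, hspan, hli⟩ := exists_linearIndependent K Λ
  have hfin : Finite b := hli.finite
  have := Fintype.ofFinite b
  let e := (Fintype.equivFin b).symm
  let M : Matrix (Fin (Fintype.card b)) ι K := fun i => (e i : ι → K)
  have hrank : M.rank = Fintype.card b := by
    have h : LinearIndependent K M.row := hli.comp e e.injective
    rw [h.rank_matrix, Fintype.card_fin]
  have hsurj : Function.Surjective M.mulVec := by
    change Function.Surjective M.mulVecLin
    rw [← LinearMap.range_eq_top]
    apply Submodule.eq_top_of_finrank_eq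
    rw [Module.finrank_fin_fun]
    exact hrank
  obtain ⟨G, hG⟩ := Matrix.mulVec_surjective_iff_exists_right_inverse.1 hsurj
  refine ⟨_, M, G, fun i => hbΛ (e i).2, hG, ?_⟩
  have h1 := LinearMap.finrank_range_add_finrank_ker M.mulVecLin
  rw [Module.finrank_fintype_fun_eq_card] at h1
  have h2 : LinearMap.ker M.mulVecLin ≤ linearSolutions Λ := by
    intro c hc l hl
    have hle : Submodule.span K Λ ≤
        LinearMap.ker (Fintype.linearCombination K c : (ι → K) →ₗ[K] K) := by
      rw [← hspan, Submodule.span_le]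
      intro x hx
      have : ∑ i, M (e.symm ⟨x, hx⟩) i * c i = 0 :=
        congrFun (LinearMap.mem_ker.1 hc) (e.symm ⟨x, hx⟩)
      simpa [Fintype.linearCombination_apply, M] using this
    simpa [Fintype.linearCombination_apply] using hle (Submodule.subset_span hl)
  have h3 := Submodule.finrank_mono h2
  have h4 := finrank_linearSolutions_le M fun i => hbΛ (e i).2
  rw [hrank] at h4
  rw [Matrix.rank] at hrank
  omega

theorem isOpen_ne_zero {R : Type u} [CommRing R] [Algebra K R] (f : R) :
    IsOpen[zariskiPoints K R] {p : R →ₐ[K] K | p f ≠ 0} :=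
  ⟨PrimeSpectrum.basicOpen f, PrimeSpectrum.isOpen_basicOpen, rfl⟩

/-- Near `p₀` the rank cannot drop: with `G` held constant, the determinant of (chosen equations)
times `G` is an element of `R` equal to `1` at `p₀`, and wherever it is nonzero the chosen equations
stay independent. -/
theorem isClosed_le_finrank_linearSolutions {R : Type u} [CommRing R] [Algebra K R] {ι : Type*}
    [Fintype ι] (Λ : Set (ι → R)) (q : ℕ) :
    IsClosed[zariskiPoints K R] {p : R →ₐ[K] K |
      q ≤ Module.finrank K (linearSolutions ((fun l i => p (l i)) '' Λ))} := by
  let _ := zariskiPoints K R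
  rw [← isOpen_compl_iff, isOpen_iff_forall_mem_open]
  intro p₀ hp₀
  obtain ⟨s, M, G, hM, hMG, hcard⟩ := exists_matrix_of_linearSolutions ((fun l i => p₀ (l i)) '' Λ)
  choose l hl hlM using hM
  have hdet : ∀ p : R →ₐ[K] K, p ((Matrix.of l * G.map (algebraMap K R)).det) =
      ((Matrix.of fun i j => p (l i j)) * G).det := by
    intro p
    rw [AlgHom.map_det]
    congr 1
    ext i j
    simp [Matrix.mul_apply]
  refine ⟨_, ?_, isOpen_ne_zero (K := K) ((Matrix.of l * G.map (algebraMap K R)).det), ?_⟩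
  · intro p hp
    have hp : p _ ≠ 0 := hp
    rw [hdet] at hp
    have h1 := Matrix.rank_of_isUnit _ ((Matrix.isUnit_iff_isUnit_det _).2 hp.isUnit)
    have h2 := Matrix.rank_mul_le_left (Matrix.of fun i j => p (l i j)) G
    have h3 := finrank_linearSolutions_le (Λ := (fun l i => p (l i)) '' Λ)
      (Matrix.of fun i j => p (l i j)) fun i => ⟨l i, hl i, rfl⟩
    simp only [Set.mem_compl_iff, Set.mem_ofPred_eq, not_le] at hp₀ ⊢
    rw [Fintype.card_fin] at h1
    omega
  · have hM' : (Matrix.of fun i j => p₀ (l i j)) = M := by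
      ext i j
      exact congrFun (hlM i) j
    change p₀ _ ≠ 0
    rw [hdet, hM', hMG, Matrix.det_one]
    exact one_ne_zero

/-- The polynomial vectors with given coefficients in degrees less than `m`. -/
def polynomialVector (K : Type u) [Field K] (n m : ℕ) :
    (Fin n × Fin m → K) →ₗ[K] (Fin n → K[X]) :=
  LinearMap.pi fun j => ∑ t : Fin m, Polynomial.monomial t ∘ₗ LinearMap.proj (j, t)

theorem polynomialVector_apply {n m : ℕ} (c : Fin n × Fin m → K) (j : Fin n) :
    polynomialVector K n m c j = ∑ t : Fin m, Polynomial.monomial t (c (j, t)) := by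
  simp [polynomialVector]

theorem coeff_polynomialVector {n m : ℕ} (c : Fin n × Fin m → K) (j : Fin n) (t : Fin m) :
    (polynomialVector K n m c j).coeff t = c (j, t) := by
  rw [polynomialVector_apply, Polynomial.finsetSum_coeff, Finset.sum_eq_single t]
  · simp
  · intro s _ hs
    rw [Polynomial.coeff_monomial, if_neg (fun h => hs (Fin.ext h))]
  · simp

/-- Comparing coefficients turns polynomial orthogonality into scalar equations in the `n * m`
coefficients of the unknown vector. -/
theorem finrank_solutions_eq {n : ℕ} (Γ : Set (Fin n → K[X])) (m : ℕ) :
    Module.finrank K (solutions Γ m) = Module.finrank K (linearSolutions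
      {l : Fin n × Fin m → K | ∃ γ ∈ Γ, ∃ d : ℕ, ∀ j t, (γ j * X ^ (t : ℕ)).coeff d = l (j, t)}) := by
  have hinj : Function.Injective (polynomialVector K n m) := by
    intro c c' h
    funext ⟨j, t⟩
    rw [← coeff_polynomialVector c, h, coeff_polynomialVector]
  have hiff : ∀ (γ : Fin n → K[X]) (c : Fin n × Fin m → K),
      ∑ j, γ j * polynomialVector K n m c j = 0 ↔
        ∀ d : ℕ, ∑ jt : Fin n × Fin m, (γ jt.1 * X ^ (jt.2 : ℕ)).coeff d * c jt = 0 := by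
    intro γ c
    rw [Polynomial.ext_iff]
    refine forall_congr' fun d => ?_
    rw [Polynomial.finsetSum_coeff, Fintype.sum_prod_type, Polynomial.coeff_zero]
    refine Eq.congr_left (Finset.sum_congr rfl fun j _ => ?_)
    rw [polynomialVector_apply, Finset.mul_sum, Polynomial.finsetSum_coeff]
    refine Finset.sum_congr rfl fun t _ => ?_
    rw [← Polynomial.C_mul_X_pow_eq_monomial, mul_left_comm, Polynomial.coeff_C_mul, mul_comm]
  rw [← finrank_map_of_injective (polynomialVector K n m) hinj]
  refine congrArg (fun N : Submodule K (Fin n → K[X]) => Module.finrank K N) ?_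
  ext x
  constructor
  · rintro ⟨hx1, hx2⟩
    have hx : polynomialVector K n m (fun jt => (x jt.1).coeff jt.2) = x := by
      funext j
      ext d
      by_cases hd : d < m
      · exact coeff_polynomialVector _ j ⟨d, hd⟩
      · have h1 := Polynomial.mem_degreeLT.1 (hx1 j)
        rw [Polynomial.degree_lt_iff_coeff_zero] at h1
        rw [h1 d (not_lt.1 hd), polynomialVector_apply, Polynomial.finsetSum_coeff]
        refine Finset.sum_eq_zero fun t _ => ?_
        rw [Polynomial.coeff_monomial, if_neg (by omega)]
    refine ⟨_, ?_, hx⟩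
    rintro l ⟨γ, hγ, d, hl⟩
    have := (hiff γ (fun jt => (x jt.1).coeff jt.2)).1 (by rw [hx]; exact hx2 γ hγ) d
    rw [← this]
    exact Finset.sum_congr rfl fun jt _ => by rw [← hl]
  · rintro ⟨c, hc, rfl⟩
    refine ⟨fun j => ?_, fun γ hγ => ?_⟩
    · rw [polynomialVector_apply]
      refine sum_mem fun t _ => Polynomial.mem_degreeLT.2 ?_
      exact (Polynomial.degree_monomial_le _ _).trans_lt (by exact_mod_cast t.2)
    · rw [hiff]
      exact fun d => hc (fun jt => (γ jt.1 * X ^ (jt.2 : ℕ)).coeff d) ⟨γ, hγ, d, fun _ _ => rfl⟩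

theorem isClosed_le_finrank_solutions {R : Type u} [CommRing R] [Algebra K R] {n : ℕ}
    (Γ : Set (Fin n → R[X])) (m q : ℕ) :
    IsClosed[zariskiPoints K R] {p : R →ₐ[K] K |
      q ≤ Module.finrank K (solutions
        ((fun γ j => Polynomial.mapRingHom p.toRingHom (γ j)) '' Γ) m)} := by
  convert! isClosed_le_finrank_linearSolutions (K := K)
    {l : Fin n × Fin m → R | ∃ γ ∈ Γ, ∃ d : ℕ, ∀ j t, (γ j * X ^ (t : ℕ)).coeff d = l (j, t)} q
    using 3 with p
  have hcoeff : ∀ (f : R[X]) (t d : ℕ),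
      (Polynomial.mapRingHom p.toRingHom f * X ^ t).coeff d = p ((f * X ^ t).coeff d) := by
    intro f t d
    have : Polynomial.mapRingHom p.toRingHom f * X ^ t =
        Polynomial.mapRingHom p.toRingHom (f * X ^ t) := by simp
    rw [this, Polynomial.coe_mapRingHom, Polynomial.coeff_map]
    rfl
  rw [finrank_solutions_eq]
  refine Eq.to_iff (congrArg (fun Λ : Set (Fin n × Fin m → K) =>
    q ≤ Module.finrank K (linearSolutions Λ)) ?_)
  ext l
  constructor
  · rintro ⟨_, ⟨γ, hγ, rfl⟩, d, h⟩
    refine ⟨fun jt => (γ jt.1 * X ^ (jt.2 : ℕ)).coeff d, ⟨γ, hγ, d, fun _ _ => rfl⟩, ?_⟩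
    funext ⟨j, t⟩
    rw [← h, hcoeff]
  · rintro ⟨_, ⟨γ, hγ, d, h⟩, rfl⟩
    exact ⟨_, ⟨γ, hγ, rfl⟩, d, fun j t => by rw [hcoeff, h]⟩

variable {r n : ℕ}

theorem solutions_extend {A : Type v} [CommRing A] (f : A →+* K[X])
    (N : Submodule A (Fin n → A)) (m : ℕ) :
    solutions (extend f N : Set (Fin n → K[X])) m =
      solutions ((fun v j => f (v j)) '' (N : Set (Fin n → A))) m := by
  ext x
  refine and_congr_right fun _ => ⟨fun h γ hγ => h γ (Submodule.subset_span hγ), fun h γ hγ => ?_⟩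
  have hle : extend f N ≤ LinearMap.ker (Fintype.linearCombination K[X] x) := by
    refine Submodule.span_le.2 fun γ hγ => ?_
    simpa [Fintype.linearCombination_apply] using h γ hγ
  simpa [Fintype.linearCombination_apply] using hle hγ

/-- The topology on morphisms is the final one for all families, so closedness is tested on
parameter spaces. -/
theorem isClosed_of_family {q : ℕ} (h : Morphism K r n → ℕ)
    (hfam : ∀ (R : Type u) [CommRing R] [Algebra K R] (Φ : Morphism R r n),
      IsClosed[zariskiPoints K R] {p : R →ₐ[K] K | q ≤ h (Φ.pullback p.toRingHom)}) :
    IsClosed {φ : Morphism K r n | q ≤ h φ} := by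
  refine isClosed_iSup_iff.2 fun R => isClosed_iSup_iff.2 fun _ => isClosed_iSup_iff.2 fun _ =>
    isClosed_iSup_iff.2 fun Φ => isClosed_coinduced.2 (hfam R Φ)

theorem isClosed_le_finrank_quotSolutions (m q : ℕ) :
    IsClosed {φ : Morphism K r n | q ≤ Module.finrank K
      (solutions ((φ.onChart 0).toSubmodule : Set (Fin n → K[X])) m)} := by
  refine isClosed_of_family _ fun R _ _ Φ => ?_
  convert! isClosed_le_finrank_solutions (K := K)
    ((Φ.onChart 0).toSubmodule : Set (Fin n → R[X])) m q using 3 with p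
  refine Eq.to_iff (congrArg (fun N : Submodule K (Fin n → K[X]) => q ≤ Module.finrank K N)
    (solutions_extend (Polynomial.mapRingHom p.toRingHom) (Φ.onChart 0).toSubmodule m))

theorem isClosed_le_finrank_subSolutions (m q : ℕ) :
    IsClosed {φ : Morphism K r n | q ≤ Module.finrank K (φ.subSolutions m)} := by
  refine isClosed_of_family _ fun R _ _ Φ => ?_
  have := (Φ.onChart 0).projective_quotient
  -- A projector for the whole family specializes to a projector at each parameter, which makes
  -- membership in the subbundle a system of equations with coefficients in `R`.
  obtain ⟨D, hD⟩ := exists_isProjector (Φ.onChart 0).toSubmodule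
  convert! isClosed_le_finrank_solutions (K := K) (Set.range fun i j => D i j) m q using 3 with p
  rw [Morphism.subSolutions_eq (Φ.pullback p.toRingHom)
    (hD.map (Polynomial.mapRingHom p.toRingHom)), ← Set.range_comp]
  rfl

end Semicontinuity

/-! ### Section numbers and sums of squares of splitting types. -/

section Sequences

theorem two_mul_sum_toNat {x e : ℤ} (hx : 0 ≤ x) (hxe : x ≤ e) :
    2 * ∑ m ∈ Finset.range (e.toNat + 1), (((m : ℤ) - x).toNat : ℤ) = (e - x) * (e - x + 1) := by
  lift x to ℕ using hx
  lift e to ℕ using (by omega)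
  have hxe : x ≤ e := by exact_mod_cast hxe
  rw [Int.toNat_natCast]
  induction e, hxe using Nat.le_induction with
  | base =>
    rw [Finset.sum_eq_zero]
    · ring
    · intro m hm
      have := Finset.mem_range.1 hm
      omega
  | succ e hxe ih =>
    rw [Finset.sum_range_succ, mul_add, ih (by omega)]
    have : ((((e + 1 : ℕ) : ℤ) - x).toNat : ℤ) = e + 1 - x := by omega
    rw [this]
    push_cast
    ring

variable {ι κ : Type*} [Fintype ι] [Fintype κ]

/-- `a` is a family of non-negative integers with sum `e`. -/
structure IsType (e : ℕ) (a : ι → ℤ) : Prop where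
  nonneg : ∀ i, 0 ≤ a i
  sum_eq : ∑ i, a i = e

theorem IsType.le {e : ℕ} {a : ι → ℤ} (ha : IsType e a) (i : ι) : a i ≤ e := by
  rw [← ha.sum_eq]
  exact Finset.single_le_sum (fun j _ => ha.nonneg j) (Finset.mem_univ i)

/-- The inner sums over `m` are triangular numbers. With the sum of `a` fixed, only the sum of
squares can vary. -/
theorem IsType.two_mul_sum {e : ℕ} {a : ι → ℤ} (ha : IsType e a) :
    2 * ∑ m ∈ Finset.range (e + 1), ((∑ i, ((m : ℤ) - a i).toNat : ℕ) : ℤ) =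
      Fintype.card ι * (e * (e + 1)) - (2 * e + 1) * e + ∑ i, a i ^ 2 := by
  push_cast
  rw [Finset.sum_comm, Finset.mul_sum]
  have h : ∀ i, 2 * ∑ m ∈ Finset.range (e + 1), (((m : ℤ) - a i).toNat : ℤ) =
      e * (e + 1) - (2 * e + 1) * a i + a i ^ 2 := by
    intro i
    have := two_mul_sum_toNat (ha.nonneg i) (ha.le i)
    rw [Int.toNat_natCast] at this
    rw [this]
    ring
  rw [Finset.sum_congr rfl fun i _ => h i, Finset.sum_add_distrib, Finset.sum_sub_distrib,
    ← Finset.mul_sum _ _ (2 * (e : ℤ) + 1), ha.sum_eq, Finset.sum_const, Finset.card_univ, nsmul_eq_mul]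

/-- Finitely many section numbers suffice, which keeps the open set in the proof of local closedness
a finite intersection. -/
theorem IsType.eq_of_sum_toNat_eq {e k : ℕ} {a b : Fin k → ℤ} (ha : IsType e a) (hb : IsType e b)
    (ha' : Monotone a) (hb' : Monotone b)
    (h : ∀ m ≤ e, ∑ i, ((m : ℤ) - a i).toNat = ∑ i, ((m : ℤ) - b i).toNat) : a = b := by
  obtain ⟨σ, hσ⟩ := exists_equiv_of_sum_toNat_eq (a := fun i => -a i) (b := fun i => -b i) (by
    intro t
    -- With `m = t + 1`: for `m ≤ 0` all terms vanish, since the types are non-negative. For `m > e`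
    -- no term is truncated, and the sum is `k * m - e` for every type.
    rcases lt_or_ge t 0 with ht | ht
    · rw [Finset.sum_eq_zero, Finset.sum_eq_zero]
      · intro i _
        have := hb.nonneg i
        omega
      · intro i _
        have := ha.nonneg i
        omega
    rcases le_or_gt (t + 1) e with hte | hte
    · have h1 := h (t + 1).toNat (by omega)
      rw [Int.toNat_of_nonneg (by omega)] at h1
      have h2 : ∀ x : ℤ, t + -x + 1 = t + 1 - x := fun x => by ring
      simpa only [h2] using h1
    · have key : ∀ c : Fin k → ℤ, IsType e c →
          ((∑ i, (t + -c i + 1).toNat : ℕ) : ℤ) = k * (t + 1) - e := by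
        intro c hc
        have : ∀ i, ((t + -c i + 1).toNat : ℤ) = (t + 1) - c i := fun i => by
          have := hc.le i
          omega
        push_cast
        rw [Finset.sum_congr rfl fun i _ => this i, Finset.sum_sub_distrib, hc.sum_eq]
        simp
      exact_mod_cast (key a ha).trans (key b hb).symm)
  have h1 : b ∘ σ = a := funext fun i => neg_inj.1 (hσ i)
  have := Tuple.unique_monotone (f := b) (σ := σ) (τ := Equiv.refl _) (h1 ▸ ha') hb'
  exact h1.symm.trans this

theorem IsType.sum_add_sq {e : ℕ} {a : ι → ℤ} {b : κ → ℤ} (ha : IsType e a) (hb : IsType e b) :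
    ∑ p : ι × κ, (a p.1 + b p.2) ^ 2 =
      Fintype.card κ * ∑ i, a i ^ 2 + 2 * e ^ 2 + Fintype.card ι * ∑ j, b j ^ 2 := by
  rw [Fintype.sum_prod_type]
  simp only [add_sq, Finset.sum_add_distrib, ← Finset.mul_sum, ← Finset.sum_mul, ha.sum_eq,
    hb.sum_eq, Finset.sum_const, Finset.card_univ, nsmul_eq_mul]
  ring

/-- The inequalities say that both sums of squares weakly grow, while `hsq` fixes a positive
combination of them. So nothing grows, and each termwise inequality is an equality. -/
theorem IsType.eq_of_sum_toNat_le {e k l : ℕ} (hk : 0 < k) (hl : 0 < l) {a a' : Fin k → ℤ}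
    {b b' : Fin l → ℤ} (ha : IsType e a) (hb : IsType e b) (ha' : IsType e a') (hb' : IsType e b')
    (hsq : ∑ p : Fin k × Fin l, (a p.1 + b p.2) ^ 2 = ∑ p : Fin k × Fin l, (a' p.1 + b' p.2) ^ 2)
    (hle : ∀ m : ℕ, ∑ i, ((m : ℤ) - a i).toNat ≤ ∑ i, ((m : ℤ) - a' i).toNat)
    (hle' : ∀ m : ℕ, ∑ i, ((m : ℤ) - b i).toNat ≤ ∑ i, ((m : ℤ) - b' i).toNat)
    (hma : Monotone a) (hma' : Monotone a') (hmb : Monotone b) (hmb' : Monotone b') :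
    a = a' ∧ b = b' := by
  rw [ha.sum_add_sq hb, ha'.sum_add_sq hb', Fintype.card_fin, Fintype.card_fin] at hsq
  have h1 := ha.two_mul_sum
  have h2 := ha'.two_mul_sum
  have h3 := hb.two_mul_sum
  have h4 := hb'.two_mul_sum
  rw [← Nat.cast_sum] at h1 h2 h3 h4
  have l1 := Finset.sum_le_sum fun m (_ : m ∈ Finset.range (e + 1)) => hle m
  have l2 := Finset.sum_le_sum fun m (_ : m ∈ Finset.range (e + 1)) => hle' m
  have e1 := Finset.sum_eq_sum_iff_of_le fun m (_ : m ∈ Finset.range (e + 1)) => hle m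
  have e2 := Finset.sum_eq_sum_iff_of_le fun m (_ : m ∈ Finset.range (e + 1)) => hle' m
  set A := ∑ m ∈ Finset.range (e + 1), ∑ i, ((m : ℤ) - a i).toNat
  set A' := ∑ m ∈ Finset.range (e + 1), ∑ i, ((m : ℤ) - a' i).toNat
  set B := ∑ m ∈ Finset.range (e + 1), ∑ i, ((m : ℤ) - b i).toNat
  set B' := ∑ m ∈ Finset.range (e + 1), ∑ i, ((m : ℤ) - b' i).toNat
  have l1' : (0 : ℤ) ≤ A' - A := by omega
  have l2' : (0 : ℤ) ≤ B' - B := by omega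
  have hk' : (0 : ℤ) < k := by exact_mod_cast hk
  have hl' : (0 : ℤ) < l := by exact_mod_cast hl
  -- The weights `l` and `k` are those with which the two sums of squares enter `hsq`; both
  -- differences are non-negative.
  have hsum : (l : ℤ) * (A' - A) + k * (B' - B) = 0 := by
    rw [Fintype.card_fin] at h1 h2 h3 h4
    have : 2 * ((l : ℤ) * (A' - A) + k * (B' - B)) = 0 := by
      linear_combination l * h2 - l * h1 + k * h4 - k * h3 - hsq
    omega
  have hA : A = A' := by
    have p1 := mul_nonneg hl'.le l1'
    have p2 := mul_nonneg hk'.le l2'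
    have : (l : ℤ) * (A' - A) = 0 := by linarith
    rcases mul_eq_zero.1 this with h | h <;> omega
  have hB : B = B' := by
    rw [hA, sub_self, mul_zero, zero_add] at hsum
    rcases mul_eq_zero.1 hsum with h | h <;> omega
  exact ⟨ha.eq_of_sum_toNat_eq ha' hma hma' fun m hm => e1.1 hA m (Finset.mem_range.2 (by omega)),
    hb.eq_of_sum_toNat_eq hb' hmb hmb' fun m hm => e2.1 hB m (Finset.mem_range.2 (by omega))⟩

end Sequences

/-! ### Fillings as pairs of splitting types. -/

section Fillings

variable {e r n : ℕ} {c : Fin (r * (n - r)) → ℤ}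

/-- A matrix with constant row and column differences is a sum of a function of the row and one of
the column; the normalization by `e` makes these `a` and `b` exactly. -/
theorem SplitFilling.facts (hr : 0 < r) (hrn : r < n) (F : SplitFilling e c) :
    IsType e F.a ∧ IsType e F.b ∧ ∀ i j, F.A i j = F.a i + F.b j := by
  have hs : ((n - r : ℕ) : ℚ) = (n : ℚ) - r := by rw [Nat.cast_sub hrn.le]
  have hr0 : (r : ℚ) ≠ 0 := by positivity
  have hn0 : (n : ℚ) ≠ 0 := by
    have : 0 < n := by omega
    positivity
  have hs0 : (n : ℚ) - r ≠ 0 := by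
    rw [← hs]
    have : 0 < n - r := by omega
    positivity
  have hS : ∑ i, ∑ j, (F.A i j : ℚ) = n * e := by
    rw [F.arises.degree_eq]
    field_simp
  have ha := F.arises.a_eq
  have hb := F.arises.b_eq
  refine ⟨⟨F.arises.a_nonneg, ?_⟩, ⟨F.arises.b_nonneg, ?_⟩, fun i j => ?_⟩
  · have : ((∑ i, F.a i : ℤ) : ℚ) = e := by
      push_cast
      rw [Finset.sum_congr rfl fun i _ => ha i, ← Finset.mul_sum, Finset.sum_sub_distrib, hS,
        Finset.sum_const, Finset.card_univ, Fintype.card_fin, nsmul_eq_mul]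
      field_simp
    exact_mod_cast this
  · have : ((∑ j, F.b j : ℤ) : ℚ) = e := by
      push_cast
      rw [Finset.sum_congr rfl fun i _ => hb i, ← Finset.mul_sum, Finset.sum_sub_distrib,
        Finset.sum_comm, hS, Finset.sum_const, Finset.card_univ, Fintype.card_fin, nsmul_eq_mul, hs]
      field_simp
      ring
    exact_mod_cast this
  · have h1 : ∀ i' j', (F.A i j : ℚ) + F.A i' j' = F.A i' j + F.A i j' := by
      intro i' j'
      have := F.isFilling.row_difference i i' j j'
      have h2 : F.A i j + F.A i' j' = F.A i' j + F.A i j' := by linarith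
      exact_mod_cast h2
    -- Averaging over all `i'` and `j'` expresses the entry by its row sum, its column sum and the
    -- total `n * e`.
    have h2 : ∑ i', ∑ j', ((F.A i j : ℚ) + F.A i' j') = ∑ i', ∑ j', ((F.A i' j : ℚ) + F.A i j') :=
      Finset.sum_congr rfl fun i' _ => Finset.sum_congr rfl fun j' _ => h1 i' j'
    simp only [Finset.sum_add_distrib, hS, Finset.sum_const, Finset.card_univ, Fintype.card_fin,
      nsmul_eq_mul, hs, ← Finset.mul_sum] at h2
    have h3 : (F.A i j : ℚ) = F.a i + F.b j := by
      rw [ha, hb]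
      field_simp
      linear_combination h2
    exact_mod_cast h3

theorem exists_splitFilling (hr : 0 < r) (hrn : r < n) {a : Fin r → ℤ} {b : Fin (n - r) → ℤ}
    (ha : IsType e a) (hb : IsType e b) (hma : Monotone a) (hmb : Monotone b)
    (σ : Fin r × Fin (n - r) ≃ Fin (r * (n - r))) (hσ : ∀ p, c (σ p) = a p.1 + b p.2) :
    ∃ F : SplitFilling e c, F.a = a ∧ F.b = b := by
  have hs : ((n - r : ℕ) : ℚ) = (n : ℚ) - r := by rw [Nat.cast_sub hrn.le]
  have hr0 : (r : ℚ) ≠ 0 := by positivity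
  have hn0 : (n : ℚ) ≠ 0 := by
    have : 0 < n := by omega
    positivity
  have hs0 : (n : ℚ) - r ≠ 0 := by
    rw [← hs]
    have : 0 < n - r := by omega
    positivity
  have ha' : ∑ i, (a i : ℚ) = e := by exact_mod_cast ha.sum_eq
  have hb' : ∑ j, (b j : ℚ) = e := by exact_mod_cast hb.sum_eq
  refine ⟨⟨Matrix.of fun i j => a i + b j, a, b, ⟨⟨σ, fun i j => (hσ (i, j)).symm⟩, ?_, ?_, ?_, ?_⟩,
    ⟨ha.nonneg, hma, hb.nonneg, hmb, ?_, ?_, ?_⟩⟩, rfl, rfl⟩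
  · intro j i i' h
    simpa using hma h
  · intro i j j' h
    simpa using hmb h
  · intro i i' j j'
    simp
  · intro i i' j j'
    simp
  · simp [Finset.sum_add_distrib, ← Finset.mul_sum, ha', hb', hs]
    field_simp
    ring
  · intro i
    simp [Finset.sum_add_distrib, hb', hs]
    field_simp
  · intro j
    simp [Finset.sum_add_distrib, ha']
    field_simp

theorem SplitFilling.ext_of_types (hr : 0 < r) (hrn : r < n) {F G : SplitFilling e c}
    (ha : F.a = G.a) (hb : F.b = G.b) : F = G := by
  have hA : F.A = G.A := by
    ext i j
    rw [(F.facts hr hrn).2.2, (G.facts hr hrn).2.2, ha, hb]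
  obtain ⟨A, a, b, _, _⟩ := F
  obtain ⟨A', a', b', _, _⟩ := G
  obtain rfl : A = A' := hA
  obtain rfl : a = a' := ha
  obtain rfl : b = b' := hb
  rfl

theorem finite_splitFilling (hr : 0 < r) (hrn : r < n) : Finite (SplitFilling e c) := by
  let f : SplitFilling e c → (Fin r → Set.Icc (0 : ℤ) e) × (Fin (n - r) → Set.Icc (0 : ℤ) e) :=
    fun F => (fun i => ⟨F.a i, (F.facts hr hrn).1.nonneg i, (F.facts hr hrn).1.le i⟩,
      fun j => ⟨F.b j, (F.facts hr hrn).2.1.nonneg j, (F.facts hr hrn).2.1.le j⟩)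
  refine Finite.of_injective f fun F G h => ?_
  refine SplitFilling.ext_of_types hr hrn (funext fun i => ?_) (funext fun j => ?_)
  · exact congrArg Subtype.val (congrFun (congrArg Prod.fst h) i)
  · exact congrArg Subtype.val (congrFun (congrArg Prod.snd h) j)

/-- The invariant shared by all strata of one tangent locus. -/
theorem SplitFilling.sum_sq (hr : 0 < r) (hrn : r < n) (F : SplitFilling e c) :
    ∑ p : Fin r × Fin (n - r), (F.a p.1 + F.b p.2) ^ 2 = ∑ l, c l ^ 2 := by
  obtain ⟨σ, hσ⟩ := F.isFilling.entries
  rw [← σ.sum_comp]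
  refine Finset.sum_congr rfl fun p _ => ?_
  rw [← hσ p.1 p.2, (F.facts hr hrn).2.2]

end Fillings

/-! ### The strata and the stratification. -/

section Strata

variable {K : Type u} [Field K] {e r n : ℕ}

theorem nonneg_of_sum_toNat_eq_zero {ι : Type*} [Fintype ι] {a : ι → ℤ}
    (h : ∑ i, (((0 : ℕ) : ℤ) - a i).toNat = 0) (i : ι) : 0 ≤ a i := by
  have := Finset.sum_eq_zero_iff.1 h i (Finset.mem_univ i)
  omega

theorem finrank_solutions_zero (Γ : Set (Fin n → K[X])) :
    Module.finrank K (solutions Γ 0) = 0 := by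
  have : Subsingleton (solutions Γ 0) := by
    refine subsingleton_of_forall_eq 0 fun x => Subtype.ext (funext fun j => ?_)
    have := Polynomial.mem_degreeLT.1 (x.2.1 j)
    exact Polynomial.degree_eq_bot.1 (by simpa using this)
  exact Module.finrank_zero_of_subsingleton

namespace Mor

variable (φ : Mor K e r n)

/-- Non-negativity is the case `m = 0` of the section count: a subbundle of `𝒪 ^ n` has no sections
after the twist by `-1`. -/
theorem isType_sub {ι : Type*} [Fintype ι] {a : ι → ℤ} (ha : φ.1.sub.dual.HasFrame a) :
    IsType e a := by
  refine ⟨nonneg_of_sum_toNat_eq_zero ?_, ha.sum_eq_of_hasDegree φ.2⟩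
  have := (φ.1.onChart 0).projective_quotient
  obtain ⟨D, hD⟩ := exists_isProjector (φ.1.onChart 0).toSubmodule
  rw [← φ.1.finrank_subSolutions ha, φ.1.subSolutions_eq hD, finrank_solutions_zero]

theorem isType_quot {ι : Type*} [Fintype ι] {b : ι → ℤ} (hb : φ.1.quot.HasFrame b) :
    IsType e b := by
  refine ⟨nonneg_of_sum_toNat_eq_zero ?_, ?_⟩
  · rw [← φ.1.finrank_quotSolutions hb, finrank_solutions_zero]
  · obtain ⟨m, a, ha⟩ := φ.1.sub.dual.exists_hasFrame
    have h1 := φ.1.sum_add_sum_eq_zero ha.of_dual hb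
    have h2 := (φ.isType_sub ha).sum_eq
    rw [Finset.sum_neg_distrib] at h1
    linarith

theorem exists_monotone_types (hr : r ≤ n) : ∃ (a : Fin r → ℤ) (b : Fin (n - r) → ℤ),
    Monotone a ∧ Monotone b ∧ φ.1.sub.dual.HasFrame a ∧ φ.1.quot.HasFrame b := by
  have hdual : Module.finrank K[T;T⁻¹] φ.1.sub.dual.Overlap = r := by
    obtain ⟨m, a, ha⟩ := φ.1.sub.dual.exists_hasFrame
    rw [ha.finrank_eq, ← ha.of_dual.finrank_eq, φ.1.finrank_sub hr]
  obtain ⟨a, hma, ha⟩ := VectorBundle.exists_monotone_hasFrame hdual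
  obtain ⟨b, hmb, hb⟩ := VectorBundle.exists_monotone_hasFrame φ.1.finrank_quot
  exact ⟨a, b, hma, hmb, ha, hb⟩

end Mor

/-- The morphisms with given splitting types of the universal bundles. -/
def stratum (K : Type u) [Field K] (e : ℕ) {r n : ℕ} (a : Fin r → ℤ) (b : Fin (n - r) → ℤ) :
    Set (Mor K e r n) :=
  quotLocus K e r n b ∩ subLocus K e r n a

theorem mem_stratum {a : Fin r → ℤ} {b : Fin (n - r) → ℤ} {φ : Mor K e r n} :
    φ ∈ stratum K e a b ↔ φ.1.sub.dual.HasFrame a ∧ φ.1.quot.HasFrame b := by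
  rw [and_comm, ← VectorBundle.hasSplittingType_iff, ← VectorBundle.hasSplittingType_iff]
  rfl

variable (K) in
/-- The morphisms whose universal bundles have at least as many sections in every twist as the
splitting types `a` and `b` prescribe. -/
def semicontinuityLocus (e : ℕ) {r n : ℕ} (a : Fin r → ℤ) (b : Fin (n - r) → ℤ) :
    Set (Mor K e r n) :=
  {φ | ∀ m : ℕ, ∑ i, ((m : ℤ) - a i).toNat ≤ Module.finrank K (φ.1.subSolutions m) ∧
    ∑ j, ((m : ℤ) - b j).toNat ≤
      Module.finrank K (solutions ((φ.1.onChart 0).toSubmodule : Set (Fin n → K[X])) m)}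

theorem isClosed_semicontinuityLocus (a : Fin r → ℤ) (b : Fin (n - r) → ℤ) :
    IsClosed (semicontinuityLocus K e a b) := by
  simp only [semicontinuityLocus, Set.ofPred_forall]
  refine isClosed_iInter fun m => ?_
  exact ((isClosed_le_finrank_subSolutions m _).preimage continuous_subtype_val).inter
    ((isClosed_le_finrank_quotSolutions m _).preimage continuous_subtype_val)

theorem stratum_subset_semicontinuityLocus (a : Fin r → ℤ) (b : Fin (n - r) → ℤ) :
    stratum K e a b ⊆ semicontinuityLocus K e a b := by
  intro φ hφ m
  obtain ⟨ha, hb⟩ := mem_stratum.1 hφ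
  exact ⟨(φ.1.finrank_subSolutions ha m).ge, (φ.1.finrank_quotSolutions hb m).ge⟩

/-- The stratum is cut out of the closed semicontinuity locus by the open conditions that no section
number with `m ≤ e` exceeds its prescribed value. -/
theorem isLocallyClosed_stratum (hr : r ≤ n) {a : Fin r → ℤ} {b : Fin (n - r) → ℤ}
    (ha : IsType e a) (hb : IsType e b) (hma : Monotone a) (hmb : Monotone b) :
    IsLocallyClosed (stratum K e a b) := by
  let U : Set (Mor K e r n) := ⋂ m ∈ Finset.range (e + 1),
    ({φ | ∑ i, ((m : ℤ) - a i).toNat + 1 ≤ Module.finrank K (φ.1.subSolutions m)}ᶜ ∩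
      {φ | ∑ j, ((m : ℤ) - b j).toNat + 1 ≤ Module.finrank K
        (solutions ((φ.1.onChart 0).toSubmodule : Set (Fin n → K[X])) m)}ᶜ)
  have hU : IsOpen U := isOpen_biInter_finset fun m _ =>
    ((isClosed_le_finrank_subSolutions m _).preimage continuous_subtype_val).isOpen_compl.inter
      ((isClosed_le_finrank_quotSolutions m _).preimage continuous_subtype_val).isOpen_compl
  refine ⟨U, semicontinuityLocus K e a b, hU, isClosed_semicontinuityLocus a b, ?_⟩
  apply Set.Subset.antisymm
  · intro φ hφ
    refine ⟨Set.mem_iInter₂.2 fun m _ => ?_, stratum_subset_semicontinuityLocus a b hφ⟩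
    obtain ⟨ha', hb'⟩ := mem_stratum.1 hφ
    have h1 := φ.1.finrank_subSolutions ha' m
    have h2 := φ.1.finrank_quotSolutions hb' m
    constructor
    · intro (h : _ + 1 ≤ _)
      omega
    · intro (h : _ + 1 ≤ _)
      omega
  · rintro φ ⟨hφU, hφ⟩
    obtain ⟨a', b', hma', hmb', ha', hb'⟩ := φ.exists_monotone_types hr
    have key : ∀ m ≤ e, ∑ i, ((m : ℤ) - a i).toNat = ∑ i, ((m : ℤ) - a' i).toNat ∧
        ∑ j, ((m : ℤ) - b j).toNat = ∑ j, ((m : ℤ) - b' j).toNat := by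
      intro m hm
      obtain ⟨u1, u2⟩ := Set.mem_iInter₂.1 hφU m (Finset.mem_range.2 (by omega))
      have u1 : ¬ (_ + 1 ≤ _) := u1
      have u2 : ¬ (_ + 1 ≤ _) := u2
      obtain ⟨l1, l2⟩ := hφ m
      rw [φ.1.finrank_subSolutions ha'] at u1 l1
      rw [φ.1.finrank_quotSolutions hb'] at u2 l2
      omega
    obtain rfl := ha.eq_of_sum_toNat_eq (φ.isType_sub ha') hma hma' fun m hm => (key m hm).1
    obtain rfl := hb.eq_of_sum_toNat_eq (φ.isType_quot hb') hmb hmb' fun m hm => (key m hm).2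
    exact mem_stratum.2 ⟨ha', hb'⟩

theorem isStratifiedBy_tangentLocus (hr : 0 < r) (hrn : r < n) (c : Fin (r * (n - r)) → ℤ) :
    IsStratifiedBy (tangentLocus K e r n c)
      (fun F : SplitFilling e c => stratum K e F.a F.b) where
  finite := finite_splitFilling hr hrn
  iUnion_eq := by
    apply Set.Subset.antisymm
    · refine Set.iUnion_subset fun F φ hφ => ?_
      obtain ⟨ha, hb⟩ := mem_stratum.1 hφ
      obtain ⟨σ, hσ⟩ := F.isFilling.entries
      refine VectorBundle.hasSplittingType_iff.2 ?_
      convert! (ha.tensor hb).reindex σ using 1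
      funext l
      obtain ⟨p, rfl⟩ := σ.surjective l
      rw [Function.comp_apply, σ.symm_apply_apply, ← (F.facts hr hrn).2.2]
      exact (hσ p.1 p.2).symm
    · intro φ hφ
      obtain ⟨a, b, hma, hmb, ha, hb⟩ := φ.exists_monotone_types hrn.le
      obtain ⟨σ, hσ⟩ := (ha.tensor hb).exists_equiv (VectorBundle.hasSplittingType_iff.1 hφ)
      obtain ⟨F, rfl, rfl⟩ := exists_splitFilling hr hrn (φ.isType_sub ha) (φ.isType_quot hb)
        hma hmb σ hσ
      exact Set.mem_iUnion.2 ⟨F, mem_stratum.2 ⟨ha, hb⟩⟩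
  disjoint F G hFG := by
    refine Set.disjoint_left.2 fun φ hF hG => hFG ?_
    obtain ⟨ha, hb⟩ := mem_stratum.1 hF
    obtain ⟨ha', hb'⟩ := mem_stratum.1 hG
    exact SplitFilling.ext_of_types hr hrn
      (ha.eq_of_monotone ha' F.arises.a_increasing G.arises.a_increasing)
      (hb.eq_of_monotone hb' F.arises.b_increasing G.arises.b_increasing)
  locallyClosed F := isLocallyClosed_stratum hrn.le (F.facts hr hrn).1 (F.facts hr hrn).2.1
    F.arises.a_increasing F.arises.b_increasing
  frontier F G := by
    rintro ⟨φ, hφF, hφG⟩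
    -- A point of the closure of stratum `F` lying in stratum `G` has section numbers at least those
    -- of `F`. The common sum of squares then forces `F = G`, so the required inclusion is trivial.
    have hφ := closure_minimal (stratum_subset_semicontinuityLocus F.a F.b)
      (isClosed_semicontinuityLocus F.a F.b) hφF
    obtain ⟨ha, hb⟩ := mem_stratum.1 hφG
    obtain ⟨h1, h2⟩ := IsType.eq_of_sum_toNat_le hr (by omega) (F.facts hr hrn).1
      (F.facts hr hrn).2.1 (G.facts hr hrn).1 (G.facts hr hrn).2.1
      ((F.sum_sq hr hrn).trans (G.sum_sq hr hrn).symm)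
      (fun m => (hφ m).1.trans (φ.1.finrank_subSolutions ha m).le)
      (fun m => (hφ m).2.trans (φ.1.finrank_quotSolutions hb m).le)
      F.arises.a_increasing G.arises.a_increasing F.arises.b_increasing G.arises.b_increasing
    rw [SplitFilling.ext_of_types hr hrn h1 h2]
    exact subset_closure

end Strata

end GrassmannianCurves

end

theorem mainTheorem5 {K : Type*} [Field K] [IsAlgClosed K] [CharZero K] (n r e : ℕ)
    (hn : 4 ≤ n) (hr : 2 ≤ r) (hrn : r ≤ n - 2) (he : 1 ≤ e) (c : Fin (r * (n - r)) → ℤ) :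
    GrassmannianCurves.IsStratifiedBy
      (GrassmannianCurves.tangentLocus K e r n c)
      (fun F : GrassmannianCurves.SplitFilling e c =>
        GrassmannianCurves.quotLocus K e r n F.b ∩ GrassmannianCurves.subLocus K e r n F.a) :=
  GrassmannianCurves.isStratifiedBy_tangentLocus (by omega) (by omega) c
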